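/- All graphs are finite and loopless and may have multiple edges. A signed graph $(G,\sigma)$ is a graph $G$ with a map $\sigma:E(G)\to\{\pm1\}$; an edge $e$ is positive if $\sigma(e)=+1$, and the sign $\sigma(F)$ of a subgraph $F$ is the product of the signs of its edges ($+1$ if $E(F)=\emptyset$). Each edge consists of two half edges, one at each end. An orientation of $(G,\sigma)$ assigns $\tau(h)\in\{\pm1\}$ to every half edge $h$ such that $\tau(h)\tau(h')=-\sigma(e)$ whenever $h,h'$ are the two half edges of $e$. For an integer $k\ge2$, a $k$-flow of $(G,\sigma)$ is a pair $(\tau,f)$ of an orientation $\tau$ and a function $f:E(G)\to\mathbb Z$ such that $|f(e)|<k$ for every edge $e$ and $\sum_{h}\tau(h)f(e_h)=0$ at every vertex $v$, where $h$ runs over the half edges at $v$ and $e_h$ is the edge containing $h$. Its support is $\mathrm{supp}(f)=\{e\in E(G): f(e)\ne0\}$, and it is nowhere-zero if $\mathrm{supp}(f)=E(G)$. A signed graph is flow-admissible if it has a nowhere-zero $k$-flow for some integer $k\ge2$. A $k$-flow of a graph $G$ is a $k$-flow of $G$ with all edges positive. A circuit is a connected $2$-regular graph (two parallel edges form a circuit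 of length $2$), and a $2$-factor is a spanning $2$-regular subgraph. $C(G)$ is the set of components of $G$ (an isolated vertex is a component), and $G/S$ is the graph obtained by contracting all edges of $S\subseteq E(G)$, i.e. by deleting them and identifying their ends. Signed graphs $(G,\sigma)$ and $(H,\pi)$ are isomorphic, written $(G,\sigma)\cong(H,\pi)$, if there is a graph isomorphism $g:G\to H$ with $\sigma(C)=\pi(g(C))$ for every circuit $C$ of $G$. **Lemma 3.2.** Let $f_1$ and $f_2$ be two $2$-flows of a graph $G$ such that $\mathrm{supp}(f_1)\cup\mathrm{supp}(f_2)=E(G)$, and let $\sigma$ be a signature on $G$. Then there is a signed graph $(G',\sigma')$ with $G'$ cubic and $3$-edge-colorable, $E(G)\subseteq E(G')$ and $\sigma'|_{E(G)}=\sigma$ such that the following hold. 1. If $(G,\sigma)$ is flow-admissible, then $(G',\sigma')$ is flow-admissible. 2. Let $H_1$ be the spanning subgraph of $G$ with edge set $\mathrm{supp}(f_1)$. There are a $2$-factor $J$ of $G'$ and a bijection $f:C(H_1)\to C(J)$ such that $\sigma(I)=\sigma'(f(I))$ for every $I\in C(H_1)$. 3. Let $S=E(G')\setminus E(G)$. Then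 $\sigma'(e)=+1$ for every $e\in S$, and $(G'/S,\sigma'|_{E(G'/S)})\cong(G,\sigma)$ by an isomorphism that is the identity on the edge set $E(G'/S)=E(G)$. -/

import Mathlib

open scoped Graph

universe u v

namespace Graph

variable {α α' β β' : Type*}

/-! ### Multigraphs -/

/-- The degree of a vertex (a loop would count twice). -/
noncomputable def degree (G : Graph α β) (x : α) : ℕ :=
  (G.incidenceSet x).ncard + (G.loopSet x).ncard

/-- Every vertex has degree `d`. -/
def IsRegularOfDegree (G : Graph α β) (d : ℕ) : Prop :=
  ∀ x ∈ V(G), G.degree x = d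

/-- `G` is connected: it is nonempty and any two of its vertices are joined by a walk. -/
def Connected (G : Graph α β) : Prop :=
  V(G).Nonempty ∧ ∀ x ∈ V(G), ∀ y ∈ V(G), Relation.ReflTransGen G.Adj x y

/-- The set `C(G)` of (connected) components of `G`: its connected subgraphs that contain
every edge of `G` incident with one of their vertices. -/
def components (G : Graph α β) : Set (Graph α β) :=
  {C | C ≤c G ∧ C.Connected}

/-- A circuit is a connected `2`-regular graph (two parallel edges form a circuit of length `2`). -/
def IsCircuit (C : Graph α β) : Prop :=
  C.Connected ∧ C.IsRegularOfDegree 2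

/-- A `2`-factor of `G` is a spanning `2`-regular subgraph. -/
def IsTwoFactor (J G : Graph α β) : Prop :=
  J ≤s G ∧ J.IsRegularOfDegree 2

/-- `G` has a proper edge coloring with `n` colors: distinct edges with a common end receive
distinct colors. -/
def EdgeColorable (G : Graph α β) (n : ℕ) : Prop :=
  ∃ c : β → Fin n, ∀ x e e', G.Inc e x → G.Inc e' x → e ≠ e' → c e ≠ c e'

/-- The graph `G / S`: delete the edges of `S` and identify their ends. The vertices of `G / S` are
the classes of vertices of `G` that can be joined by walks with all edges in `S`. -/
def contract (G : Graph α β) (S : Set β) : Graph (Set α) β :=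
  (G.deleteEdges S).map fun x => {y | Relation.ReflTransGen (G.restrict S).Adj x y}

/-- An isomorphism of multigraphs: bijections between the vertices and between the edges that
preserve the ends of every edge in both directions. -/
structure Iso (G : Graph α β) (H : Graph α' β') where
  vert : V(G) ≃ V(H)
  edge : E(G) ≃ E(H)
  isLink_iff : ∀ (e : E(G)) (x y : V(G)), H.IsLink (edge e) (vert x) (vert y) ↔ G.IsLink e x y

/-- The set of edges of `H` that correspond to the edges of a subgraph `C` of `G`. -/
def Iso.mapEdges {G : Graph α β} {H : Graph α' β'} (φ : Iso G H) (C : Graph α β) : Set β' :=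
  {e' | ∃ e : E(G), (e : β) ∈ E(C) ∧ (φ.edge e : β') = e'}

/-! ### Signed graphs

A signed graph is a graph `G` with a signature `σ : β → ℤˣ`, of which only the values on `E(G)`
matter; `ℤˣ = {1, -1}`. Ordinary graphs are signed graphs with constant signature `1`. -/

/-- The product of the signs of the edges in `F`; the sign of a finite subgraph `I` is
`edgeSign σ E(I)`. -/
noncomputable def edgeSign (σ : β → ℤˣ) (F : Set β) : ℤˣ :=
  ∏ᶠ e ∈ F, σ e

/-- `φ` is an isomorphism of the signed graphs `(G, σ)` and `(H, π)`: it preserves the sign of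
every circuit of `G`. -/
def Iso.IsSigned {G : Graph α β} {H : Graph α' β'} (φ : Iso G H) (σ : β → ℤˣ) (π : β' → ℤˣ) :
    Prop :=
  ∀ C : Graph α β, C ≤ G → C.IsCircuit → edgeSign σ E(C) = edgeSign π (φ.mapEdges C)

/-- An orientation of a loopless signed graph. The half edge of `e` at its end `x` is the
pair `(e, x)`; it is oriented away from `x` if `τ e x = 1` and toward `x` if `τ e x = -1`. -/
def IsOrientation (G : Graph α β) (σ : β → ℤˣ) (τ : β → α → ℤˣ) : Prop :=
  ∀ e x y, G.IsLink e x y → τ e x * τ e y = -σ e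

/-- The boundary of an integer function on the edges of a finite loopless graph at a vertex. -/
noncomputable def boundary (G : Graph α β) (τ : β → α → ℤˣ) (f : β → ℤ) (x : α) : ℤ :=
  ∑ᶠ e ∈ G.incidenceSet x, (τ e x : ℤ) * f e

/-- `(τ, f)` is a `k`-flow of the signed graph `(G, σ)`. -/
structure IsFlow (G : Graph α β) (σ : β → ℤˣ) (k : ℕ) (τ : β → α → ℤˣ) (f : β → ℤ) : Prop where
  isOrientation : G.IsOrientation σ τ
  boundary_eq_zero : ∀ x ∈ V(G), G.boundary τ f x = 0
  abs_lt : ∀ e ∈ E(G), |f e| < k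

/-- The support of a flow. -/
def flowSupp (G : Graph α β) (f : β → ℤ) : Set β :=
  {e | e ∈ E(G) ∧ f e ≠ 0}

/-- `(G, σ)` admits a nowhere-zero `k`-flow for some integer `k ≥ 2`. -/
def FlowAdmissible (G : Graph α β) (σ : β → ℤˣ) : Prop :=
  ∃ k : ℕ, 2 ≤ k ∧ ∃ (τ : β → α → ℤˣ) (f : β → ℤ), G.IsFlow σ k τ f ∧ G.flowSupp f = E(G)

end Graph

/-! Direct every edge of the support of `f₁` along the flow. Then as many edges enter as leave each
vertex, so entering arcs can be matched with leaving arcs, which gives closed trails. Splicing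
trails that meet at a vertex leaves one closed trail for each component of `H₁`
(`exists_perm_sameCycle`). A dummy arc from every vertex to itself ensures that vertices missed by
`f₁` also lie on a trail.

Now pull the trails apart. Each passage of a trail through a vertex `x` becomes a path, and the
paths over `x` are closed up to a circuit by edges of color `2`. The trails themselves become the
circuits of `J`, whose edges have the colors `0` and `1` alternately. Thus each component of `H₁`
yields one circuit of `J`, with the same edges of `G` and otherwise positive new edges.

The second flow makes the alternation possible. An edge `e` of the trail is colored by `f₂ e` modulo
`2`, which prescribes the parity of the number of inner vertices of each passage. Inner vertices
must carry a third edge of color `2`: an edge outside the support of `f₁`, or a chord. Those edges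
lie in the support of `f₂`, which has even degrees, so at every vertex their number has the parity
of the number of inner vertices (`TransitionSystem.sum_parity`). The inner vertices left over can
therefore be paired by chords (`exists_attachment`).

Contracting the circuits and chords recovers `G`. A flow of `G` extends with value `1` on the
chords; conservation then determines the values on each circuit up to a constant
(`exists_sub_symm_eq`), and a large constant makes them nonzero. -/

namespace Graph

variable {α α' β β' : Type*}

/-! ### Components -/

lemma reflTransGen_adj_symm {K : Graph α β} {x y : α} (h : Relation.ReflTransGen K.Adj x y) :
    Relation.ReflTransGen K.Adj y x :=
  Relation.ReflTransGen.stdSymm.symm _ _ h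

lemma reflTransGen_adj_mem {K : Graph α β} {x y : α} (hx : x ∈ V(K))
    (h : Relation.ReflTransGen K.Adj x y) : y ∈ V(K) := by
  induction h with
  | refl => exact hx
  | tail _ h _ => exact h.right_mem

/-- The component of `K` that contains the vertex `x`. -/
def componentAt (K : Graph α β) (x : α) : Graph α β :=
  K.induce {y | Relation.ReflTransGen K.Adj x y}

lemma mem_edgeSet_componentAt {K : Graph α β} {x : α} {e : β} :
    e ∈ E(K.componentAt x) ↔ ∃ y, Relation.ReflTransGen K.Adj x y ∧ K.Inc e y := by
  rw [componentAt, edgeSet_induce]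
  constructor
  · rintro ⟨y, z, h, hy, -⟩
    exact ⟨y, hy, z, h⟩
  · rintro ⟨y, hy, z, h⟩
    exact ⟨y, z, h, hy, hy.tail h.adj⟩

lemma componentAt_adj {K : Graph α β} {x y z : α} (hy : Relation.ReflTransGen K.Adj x y)
    (h : K.Adj y z) : (K.componentAt x).Adj y z := by
  obtain ⟨e, he⟩ := h
  exact ⟨e, he, hy, hy.tail he.adj⟩

lemma componentAt_mem_components {K : Graph α β} {x : α} (hx : x ∈ V(K)) :
    K.componentAt x ∈ K.components := by
  refine ⟨IsClosedSubgraph.mk' (induce_le fun y hy => reflTransGen_adj_mem hx hy) ?_, ?_, ?_⟩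
  · rintro e y he hy
    exact mem_edgeSet_componentAt.2 ⟨y, hy, he⟩
  · exact ⟨x, Relation.ReflTransGen.refl⟩
  · have key : ∀ y, Relation.ReflTransGen K.Adj x y →
        Relation.ReflTransGen (K.componentAt x).Adj x y := by
      intro y hy
      induction hy with
      | refl => exact .refl
      | tail h h' ih => exact ih.tail (componentAt_adj h h')
    intro y hy z hz
    exact (reflTransGen_adj_symm (key y hy)).trans (key z hz)

lemma eq_componentAt {K C : Graph α β} (hC : C ∈ K.components) {x : α} (hx : x ∈ V(C)) :
    C = K.componentAt x := by
  obtain ⟨hcl, -, hconn⟩ := hC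
  have hV : V(C) = {y | Relation.ReflTransGen K.Adj x y} := by
    ext y
    constructor
    · intro hy
      exact (hconn x hx y hy).lift id fun _ _ h => h.mono hcl.le
    · intro h
      induction h with
      | refl => exact hx
      | tail _ h ih => exact (IsClosedSubgraph.mem_iff_of_adj h hcl).1 ih
  refine Graph.ext hV fun e y z => ?_
  constructor
  · intro h
    exact ⟨h.mono hcl.le, hV ▸ h.left_mem, hV ▸ h.right_mem⟩
  · rintro ⟨h, hy, -⟩
    exact (IsClosedSubgraph.isLink_congr (hV ▸ hy) hcl).2 h

lemma componentAt_eq_iff {K : Graph α β} {x y : α} :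
    K.componentAt x = K.componentAt y ↔ Relation.ReflTransGen K.Adj x y := by
  constructor
  · intro h
    have : y ∈ V(K.componentAt x) := by
      rw [h]; exact Relation.ReflTransGen.refl
    exact this
  · intro h
    have : {z | Relation.ReflTransGen K.Adj x z} = {z | Relation.ReflTransGen K.Adj y z} :=
      Set.ext fun z => ⟨fun hz => (reflTransGen_adj_symm h).trans hz, fun hz => h.trans hz⟩
    rw [componentAt, componentAt, this]

/-- A map between the vertices of two graphs that is onto and that preserves and reflects
being joined by a walk induces a bijection between the components. -/
lemma exists_components_equiv {K : Graph α β} {L : Graph α' β'} (p : α' → α)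
    (hp : ∀ w ∈ V(L), p w ∈ V(K)) (hsurj : ∀ x ∈ V(K), ∃ w ∈ V(L), p w = x)
    (hreach : ∀ w ∈ V(L), ∀ w' ∈ V(L), Relation.ReflTransGen L.Adj w w' ↔
      Relation.ReflTransGen K.Adj (p w) (p w')) :
    ∃ f : K.components ≃ L.components, ∀ I : K.components, ∃ w ∈ V(L),
      (I : Graph α β) = K.componentAt (p w) ∧ (f I : Graph α' β') = L.componentAt w := by
  have h1 : ∀ I : K.components, ∃ w ∈ V(L), (I : Graph α β) = K.componentAt (p w) := by
    rintro ⟨I, hI⟩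
    obtain ⟨x, hx⟩ := hI.2.1
    obtain ⟨w, hw, rfl⟩ := hsurj x (hI.1.le.vertexSet_mono hx)
    exact ⟨w, hw, eq_componentAt hI hx⟩
  choose w hw hI using h1
  let F : K.components → L.components :=
    fun I => ⟨L.componentAt (w I), componentAt_mem_components (hw I)⟩
  have hF : Function.Bijective F := by
    constructor
    · intro I I' h
      have h := congrArg Subtype.val h
      have h := (hreach _ (hw I) _ (hw I')).1 (componentAt_eq_iff.1 h)
      exact Subtype.ext (by rw [hI I, hI I', componentAt_eq_iff]; exact h)
    · rintro ⟨J, hJ⟩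
      obtain ⟨z, hz⟩ := hJ.2.1
      have hzL := hJ.1.le.vertexSet_mono hz
      refine ⟨⟨K.componentAt (p z), componentAt_mem_components (hp z hzL)⟩, Subtype.ext ?_⟩
      change L.componentAt _ = J
      rw [eq_componentAt hJ hz, componentAt_eq_iff, hreach _ (hw _) _ hzL, ← componentAt_eq_iff, ← hI]
  exact ⟨Equiv.ofBijective F hF, fun I => ⟨w I, hw I, hI I, rfl⟩⟩

/-! ### Expanding the vertices of a graph to circuits -/

/-- A recipe for expanding every vertex `x` of `G` to a circuit on the fibre `p ⁻¹' {x}`, which is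
traversed by `ρ`, such that every new vertex `w` gets a third edge joining it to `θ w`: either the
edge of `G` given by `lab w` or, if `lab w = none`, a chord of the circuit. The color of the
edge from `w` to `ρ w` is `κ w`, and `μ w` is the color of the third edge at `w`. The edges of `G`
in `F`, and no others, have a color distinct from `2`, and the edges of the colors `0` and `1`
connect each fibre. -/
structure CircuitExpansion (G : Graph α β) (F : Set β) (W : Type*) where
  p : W → α
  ρ : Equiv.Perm W
  θ : W → W
  lab : W → Option β
  κ : W → Fin 3
  μ : W → Fin 3
  p_mem : ∀ w, p w ∈ V(G)
  p_surj : ∀ x ∈ V(G), ∃ w, p w = x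
  p_ρ : ∀ w, p (ρ w) = p w
  ρ_ne : ∀ w, ρ w ≠ w
  sameCycle : ∀ w w', p w = p w' → ρ.SameCycle w w'
  θ_θ : ∀ w, θ (θ w) = w
  θ_ne : ∀ w, θ w ≠ w
  lab_θ : ∀ w, lab (θ w) = lab w
  isLink : ∀ w e, lab w = some e → G.IsLink e (p w) (p (θ w))
  p_θ : ∀ w, lab w = none → p (θ w) = p w
  exists_lab : ∀ e x, G.Inc e x → ∃ w, lab w = some e ∧ p w = x
  lab_inj : ∀ w w' e, lab w = some e → lab w' = some e → p w = p w' → w = w'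
  μ_θ : ∀ w, μ (θ w) = μ w
  κ_ρ_ne : ∀ w, κ (ρ w) ≠ κ w
  μ_ne : ∀ w, μ w ≠ κ w
  μ_ρ_ne : ∀ w, μ (ρ w) ≠ κ w
  μ_lab : ∀ w e, lab w = some e → (μ w ≠ 2 ↔ e ∈ F)
  connected : ∀ w w', p w = p w' → Relation.ReflTransGen
    (fun u v => (v = ρ u ∧ κ u ≠ 2) ∨ (u = ρ v ∧ κ v ≠ 2) ∨ (v = θ u ∧ μ u ≠ 2)) w w'

namespace CircuitExpansion

variable {G : Graph α β} {F : Set β} {W : Type*} (D : CircuitExpansion G F W)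

/-- The edge of the circuits from `w` to `ρ w`. -/
def cyc (_ : CircuitExpansion G F W) (w : W) : β ⊕ (W ⊕ Sym2 W) := .inr (.inl w)

/-- The edge at `w` outside the circuits. -/
def third (w : W) : β ⊕ (W ⊕ Sym2 W) :=
  match D.lab w with
  | some e => .inl e
  | none => .inr (.inr s(w, D.θ w))

lemma third_of_some {w : W} {e : β} (h : D.lab w = some e) : D.third w = .inl e := by
  simp [third, h]

lemma third_of_none {w : W} (h : D.lab w = none) : D.third w = .inr (.inr s(w, D.θ w)) := by
  simp [third, h]

lemma third_eq_inl {w : W} {e : β} : D.third w = .inl e ↔ D.lab w = some e := by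
  cases h : D.lab w <;> simp [third, h]

lemma third_ne_cyc (w w' : W) : D.third w ≠ D.cyc w' := by
  cases h : D.lab w <;> simp [third, h, cyc]

lemma cyc_injective : Function.Injective D.cyc := by
  intro w w' h
  simpa [cyc] using h

lemma third_θ (w : W) : D.third (D.θ w) = D.third w := by
  have h' := D.lab_θ w
  cases h : D.lab w with
  | none => rw [h] at h'; simp [third, h, h', D.θ_θ, Sym2.eq_swap]
  | some e => rw [h] at h'; simp [third, h, h']

/-- An edge of `G` is carried by only one new vertex over each of its two ends, and a chord is named
by its pair of ends. This is what makes the ends of an edge of `graph` well defined. -/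
lemma eq_or_eq_of_third {w w' : W} (h : D.third w' = D.third w) : w' = w ∨ w' = D.θ w := by
  cases hw : D.lab w with
  | none =>
    rw [D.third_of_none hw] at h
    cases hw' : D.lab w' with
    | none =>
      rw [D.third_of_none hw'] at h
      simp only [Sum.inr.injEq, Sym2.eq_iff] at h
      tauto
    | some e => simp [third, hw'] at h
  | some e =>
    rw [D.third_of_some hw, D.third_eq_inl] at h
    have h1 := D.isLink w e hw
    have h2 := D.isLink w' e h
    rcases h2.left_eq_or_eq h1 with h3 | h3
    · exact .inl (D.lab_inj _ _ e h hw h3)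
    · exact .inr (D.lab_inj _ _ e h (by rw [D.lab_θ, hw]) h3)

/-- The expanded graph. -/
def graph : Graph W (β ⊕ (W ⊕ Sym2 W)) where
  vertexSet := Set.univ
  IsLink f u v := (∃ w, f = D.cyc w ∧ ((u = w ∧ v = D.ρ w) ∨ (u = D.ρ w ∧ v = w))) ∨
    (f = D.third u ∧ v = D.θ u)
  isLink_symm := by
    rintro f -
    constructor
    rintro u v (⟨w, hf, h⟩ | ⟨hf, rfl⟩)
    · exact .inl ⟨w, hf, by tauto⟩
    · exact .inr ⟨by rw [D.third_θ, hf], (D.θ_θ u).symm⟩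
  eq_or_eq_of_isLink_of_isLink := by
    rintro f x y v w (⟨z, rfl, h⟩ | ⟨rfl, rfl⟩) (⟨z', hf, h'⟩ | ⟨hf, rfl⟩)
    · obtain rfl := D.cyc_injective hf
      rcases h with h | h <;> rcases h' with h' | h' <;> simp [h, h']
    · exact absurd hf.symm (D.third_ne_cyc _ _)
    · exact absurd hf (D.third_ne_cyc _ _)
    · rcases D.eq_or_eq_of_third hf with h | h
      · exact .inl h
      · exact .inr h

lemma isLink_iff {f : β ⊕ (W ⊕ Sym2 W)} {u v : W} : D.graph.IsLink f u v ↔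
    (∃ w, f = D.cyc w ∧ ((u = w ∧ v = D.ρ w) ∨ (u = D.ρ w ∧ v = w))) ∨
    (f = D.third u ∧ v = D.θ u) := Iff.rfl

lemma isLink_cyc (w : W) : D.graph.IsLink (D.cyc w) w (D.ρ w) := .inl ⟨w, rfl, .inl ⟨rfl, rfl⟩⟩

lemma isLink_third (w : W) : D.graph.IsLink (D.third w) w (D.θ w) := .inr ⟨rfl, rfl⟩

lemma inc_iff {f : β ⊕ (W ⊕ Sym2 W)} {u : W} : D.graph.Inc f u ↔
    f = D.cyc u ∨ f = D.cyc (D.ρ.symm u) ∨ f = D.third u := by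
  constructor
  · rintro ⟨v, ⟨w, rfl, ⟨rfl, rfl⟩ | ⟨rfl, rfl⟩⟩ | ⟨rfl, rfl⟩⟩ <;> simp
  · rintro (rfl | rfl | rfl)
    · exact (D.isLink_cyc u).inc_left
    · have := (D.isLink_cyc (D.ρ.symm u)).inc_right
      rwa [Equiv.apply_symm_apply] at this
    · exact (D.isLink_third u).inc_left

lemma mem_edgeSet {f : β ⊕ (W ⊕ Sym2 W)} :
    f ∈ E(D.graph) ↔ (∃ w, f = D.cyc w) ∨ ∃ w, f = D.third w := by
  constructor
  · intro h
    obtain ⟨x, y, h⟩ := exists_isLink_of_mem_edgeSet h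
    rcases D.inc_iff.1 h.inc_left with h | h | h
    exacts [.inl ⟨_, h⟩, .inl ⟨_, h⟩, .inr ⟨_, h⟩]
  · rintro (⟨w, rfl⟩ | ⟨w, rfl⟩)
    · exact (D.isLink_cyc w).edge_mem
    · exact (D.isLink_third w).edge_mem

lemma inl_mem_edgeSet {e : β} : .inl e ∈ E(D.graph) ↔ e ∈ E(G) := by
  rw [mem_edgeSet]
  constructor
  · rintro (⟨w, h⟩ | ⟨w, h⟩)
    · simp [cyc] at h
    · exact (D.isLink w e (D.third_eq_inl.1 h.symm)).edge_mem
  · intro h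
    obtain ⟨x, y, h⟩ := exists_isLink_of_mem_edgeSet h
    obtain ⟨w, hw, -⟩ := D.exists_lab e x h.inc_left
    exact .inr ⟨w, (D.third_of_some hw).symm⟩

lemma finite_edgeSet [Finite W] : E(D.graph).Finite := by
  have : E(D.graph) = Set.range D.cyc ∪ Set.range D.third := by
    ext f
    simp only [mem_edgeSet, Set.mem_union, Set.mem_range, eq_comm]
  rw [this]
  exact (Set.finite_range _).union (Set.finite_range _)

lemma isLoopless : D.graph.Loopless := by
  constructor
  rintro f u (⟨w, -, ⟨rfl, h⟩ | ⟨h, rfl⟩⟩ | ⟨-, h⟩)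
  · exact D.ρ_ne _ h.symm
  · exact D.ρ_ne _ h.symm
  · exact D.θ_ne _ h.symm

lemma incidenceSet_eq (u : W) :
    D.graph.incidenceSet u = {D.cyc u, D.cyc (D.ρ.symm u), D.third u} := by
  ext f
  simp [D.inc_iff]

lemma ρ_symm_ne (u : W) : D.ρ.symm u ≠ u := by
  intro h
  exact D.ρ_ne u (by conv_lhs => rw [← h, Equiv.apply_symm_apply])

lemma cyc_ne (u : W) : D.cyc u ≠ D.cyc (D.ρ.symm u) := fun h =>
  D.ρ_symm_ne u (D.cyc_injective h).symm

lemma isRegularOfDegree : D.graph.IsRegularOfDegree 3 := by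
  intro u _
  have h : D.graph.loopSet u = ∅ := by
    ext f
    simpa using D.isLoopless.not_isLoopAt f u
  rw [degree, h, incidenceSet_eq, Set.ncard_empty, Set.ncard_eq_three.2
    ⟨_, _, _, D.cyc_ne u, (D.third_ne_cyc _ _).symm, (D.third_ne_cyc _ _).symm, rfl⟩]

/-! ### The edge coloring and the `2`-factor -/

open Classical in
/-- The coloring of the edges of the expanded graph. -/
noncomputable def color : β ⊕ (W ⊕ Sym2 W) → Fin 3
  | .inr (.inl w) => D.κ w
  | f => if h : ∃ w, D.third w = f then D.μ h.choose else 0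

lemma color_cyc (w : W) : D.color (D.cyc w) = D.κ w := by
  simp [color, cyc]

/-- The vertex chosen in `color` is `w` or `θ w`, and `μ` agrees on the two. -/
lemma color_third (w : W) : D.color (D.third w) = D.μ w := by
  have key : ∀ f, (∃ w', D.third w' = f) → ∃ w', D.third w' = f ∧ D.color f = D.μ w' := by
    rintro f hf
    refine ⟨hf.choose, hf.choose_spec, ?_⟩
    rcases f with e | w' | s
    · simp only [color, dif_pos hf]
    · exact absurd hf.choose_spec (D.third_ne_cyc _ _)
    · simp only [color, dif_pos hf]
  obtain ⟨w', h1, h2⟩ := key _ ⟨w, rfl⟩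
  rw [h2]
  rcases D.eq_or_eq_of_third h1 with h | h
  · rw [h]
  · rw [h, D.μ_θ]

lemma κ_symm_ne (u : W) : D.κ u ≠ D.κ (D.ρ.symm u) := by
  have := D.κ_ρ_ne (D.ρ.symm u)
  rwa [Equiv.apply_symm_apply] at this

lemma μ_ne_symm (u : W) : D.μ u ≠ D.κ (D.ρ.symm u) := by
  have := D.μ_ρ_ne (D.ρ.symm u)
  rwa [Equiv.apply_symm_apply] at this

lemma edgeColorable : D.graph.EdgeColorable 3 := by
  refine ⟨D.color, fun u e e' he he' hne => ?_⟩
  have h1 := D.κ_symm_ne u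
  have h2 := D.μ_ne_symm u
  have h3 := D.μ_ne u
  rcases D.inc_iff.1 he with rfl | rfl | rfl <;> rcases D.inc_iff.1 he' with rfl | rfl | rfl <;>
    first
    | exact absurd rfl hne
    | (simp only [color_cyc, color_third]
       first
       | assumption
       | exact Ne.symm (by assumption))

/-- The `2`-factor formed by the edges of the colors `0` and `1`. -/
noncomputable def factor : Graph W (β ⊕ (W ⊕ Sym2 W)) := D.graph.restrict {f | D.color f ≠ 2}

lemma factor_inc {f : β ⊕ (W ⊕ Sym2 W)} {u : W} :
    D.factor.Inc f u ↔ (f = D.cyc u ∨ f = D.cyc (D.ρ.symm u) ∨ f = D.third u) ∧ D.color f ≠ 2 := by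
  rw [factor, restrict_inc, inc_iff, Set.mem_ofPred_eq]

lemma isTwoFactor : D.factor.IsTwoFactor D.graph := by
  refine ⟨⟨restrict_le, rfl⟩, fun u _ => ?_⟩
  have h : D.factor.loopSet u = ∅ := by
    ext f
    simp only [mem_loopSet, Set.mem_empty_iff_false, iff_false]
    exact fun hf => D.isLoopless.not_isLoopAt f u (hf.mono restrict_le)
  rw [degree, h, Set.ncard_empty, add_zero, Set.ncard_eq_two]
  have h1 := D.κ_symm_ne u
  have h2 := D.μ_ne_symm u
  have h3 := D.μ_ne u
  -- The three edges at `u` have pairwise distinct colors among three, so exactly one of them is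
  -- missing from the factor.
  have hs : D.κ u = 2 ∨ D.κ (D.ρ.symm u) = 2 ∨ D.μ u = 2 := by
    generalize D.κ u = a at *
    generalize D.κ (D.ρ.symm u) = b at *
    generalize D.μ u = c at *
    revert a b c
    decide
  rcases hs with hs | hs | hs
  · refine ⟨_, _, (D.third_ne_cyc u (D.ρ.symm u)).symm, ?_⟩
    ext f
    rw [mem_incidenceSet, factor_inc, Set.mem_insert_iff, Set.mem_singleton_iff]
    constructor
    · rintro ⟨rfl | hf, hc⟩
      · exact absurd (by rw [color_cyc, hs]) hc
      · exact hf
    · rintro (rfl | rfl)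
      · exact ⟨by simp, by rw [color_cyc, ← hs]; exact h1.symm⟩
      · exact ⟨by simp, by rw [color_third, ← hs]; exact h3⟩
  · refine ⟨_, _, (D.third_ne_cyc u u).symm, ?_⟩
    ext f
    rw [mem_incidenceSet, factor_inc, Set.mem_insert_iff, Set.mem_singleton_iff]
    constructor
    · rintro ⟨rfl | rfl | rfl, hc⟩
      · simp
      · exact absurd (by rw [color_cyc, hs]) hc
      · simp
    · rintro (rfl | rfl)
      · exact ⟨by simp, by rw [color_cyc, ← hs]; exact h1⟩
      · exact ⟨by simp, by rw [color_third, ← hs]; exact h2⟩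
  · refine ⟨_, _, D.cyc_ne u, ?_⟩
    ext f
    rw [mem_incidenceSet, factor_inc, Set.mem_insert_iff, Set.mem_singleton_iff]
    constructor
    · rintro ⟨rfl | rfl | rfl, hc⟩
      · simp
      · simp
      · exact absurd (by rw [color_third, hs]) hc
    · rintro (rfl | rfl)
      · exact ⟨by simp, by rw [color_cyc, ← hs]; exact h3.symm⟩
      · exact ⟨by simp, by rw [color_cyc, ← hs]; exact h2.symm⟩

lemma factor_adj_iff {u v : W} : D.factor.Adj u v ↔
    (v = D.ρ u ∧ D.κ u ≠ 2) ∨ (u = D.ρ v ∧ D.κ v ≠ 2) ∨ (v = D.θ u ∧ D.μ u ≠ 2) := by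
  constructor
  · rintro ⟨f, hf, ⟨w, rfl, ⟨rfl, rfl⟩ | ⟨rfl, rfl⟩⟩ | ⟨rfl, rfl⟩⟩
    · exact .inl ⟨rfl, by simpa [color_cyc] using hf⟩
    · exact .inr (.inl ⟨rfl, by simpa [color_cyc] using hf⟩)
    · exact .inr (.inr ⟨rfl, by simpa [color_third] using hf⟩)
  · rintro (⟨rfl, h⟩ | ⟨rfl, h⟩ | ⟨rfl, h⟩)
    · exact ⟨_, by simpa [color_cyc] using h, D.isLink_cyc u⟩
    · exact ⟨_, by simpa [color_cyc] using h, (D.isLink_cyc v).symm⟩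
    · exact ⟨_, by simpa [color_third] using h, D.isLink_third u⟩

lemma factor_connected {w w' : W} (h : D.p w = D.p w') :
    Relation.ReflTransGen D.factor.Adj w w' :=
  (D.connected w w' h).lift id fun _ _ h => D.factor_adj_iff.2 h

/-- A walk in the factor projects to a walk along edges of `F`, since the other edges stay inside
fibres. Conversely, a walk along edges of `F` lifts because any two vertices of a fibre are joined
in the factor, possibly by a walk that leaves the fibre. -/
lemma factor_reach_iff {w w' : W} : Relation.ReflTransGen D.factor.Adj w w' ↔
    Relation.ReflTransGen (G.restrict F).Adj (D.p w) (D.p w') := by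
  constructor
  · intro h
    induction h with
    | refl => exact .refl
    | @tail u v _ h ih =>
      refine ih.trans ?_
      rcases D.factor_adj_iff.1 h with ⟨rfl, -⟩ | ⟨rfl, -⟩ | ⟨rfl, hμ⟩
      · rw [D.p_ρ]
      · rw [D.p_ρ]
      · cases hu : D.lab u with
        | none => rw [D.p_θ u hu]
        | some e => exact .single ⟨e, (D.μ_lab u e hu).1 hμ, D.isLink u e hu⟩
  · intro h
    generalize hx : D.p w = x at h
    generalize hy : D.p w' = y at h
    induction h generalizing w' with
    | refl => exact D.factor_connected (hx.trans hy.symm)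
    | @tail y z _ h ih =>
      obtain ⟨e, he, hl⟩ := h
      obtain ⟨u, hu, rfl⟩ := D.exists_lab e y hl.inc_left
      -- Reach the vertex `u` that carries `e`, cross `e` to `θ u`, and continue inside the fibre
      -- over `z`.
      refine (ih rfl).trans (.head ?_ (D.factor_connected (w := D.θ u) ?_))
      · exact D.factor_adj_iff.2 (.inr (.inr ⟨rfl, (D.μ_lab u e hu).2 he⟩))
      · rw [hy]
        exact (D.isLink u e hu).right_unique hl

/-- The edges of the component of the factor at `w` are those of the component of the
subgraph of `G` at `p w`, together with new edges. -/
lemma inl_mem_factor_componentAt {w : W} {e : β} :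
    .inl e ∈ E(D.factor.componentAt w) ↔ e ∈ E((G.restrict F).componentAt (D.p w)) := by
  rw [mem_edgeSet_componentAt, mem_edgeSet_componentAt]
  constructor
  · rintro ⟨u, hu, hf⟩
    obtain ⟨h | h | h, hc⟩ := D.factor_inc.1 hf
    · simp [cyc] at h
    · simp [cyc] at h
    · have hl := D.third_eq_inl.1 h.symm
      rw [h, color_third, D.μ_lab u e hl] at hc
      exact ⟨D.p u, D.factor_reach_iff.1 hu, restrict_inc.2 ⟨(D.isLink u e hl).inc_left, hc⟩⟩
  · rintro ⟨x, hx, he⟩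
    obtain ⟨he, hF⟩ := restrict_inc.1 he
    obtain ⟨u, hu, rfl⟩ := D.exists_lab e x he
    refine ⟨u, D.factor_reach_iff.2 hx, D.factor_inc.2 ⟨?_, ?_⟩⟩
    · simp [D.third_of_some hu]
    · rw [← D.third_of_some hu, color_third, D.μ_lab u e hu]
      exact hF

/-- The signature that extends `σ` by `1` on the new edges. -/
def sign (_ : CircuitExpansion G F W) (σ : β → ℤˣ) : β ⊕ (W ⊕ Sym2 W) → ℤˣ :=
  Sum.elim σ fun _ => 1

/-- New edges have sign `1` and do not affect the product. -/
lemma edgeSign_sign (σ : β → ℤˣ) {A : Set (β ⊕ (W ⊕ Sym2 W))} {B : Set β}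
    (h : ∀ e, .inl e ∈ A ↔ e ∈ B) : edgeSign (D.sign σ) A = edgeSign σ B := by
  have h1 : edgeSign σ B = edgeSign (D.sign σ) (Sum.inl '' B) := by
    rw [edgeSign, edgeSign, finprod_mem_image Sum.inl_injective.injOn]
    rfl
  rw [h1, edgeSign, edgeSign]
  refine finprod_mem_inter_mulSupport_eq' _ _ _ fun f hf => ?_
  rcases f with e | f
  · simp [h]
  · simp [sign] at hf

lemma exists_factor_components_equiv (σ : β → ℤˣ) :
    ∃ f : (G.restrict F).components ≃ D.factor.components, ∀ I : (G.restrict F).components,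
      edgeSign σ E((I : Graph α β)) = edgeSign (D.sign σ) E((f I : Graph W _)) := by
  obtain ⟨f, hf⟩ := exists_components_equiv (K := G.restrict F) (L := D.factor) D.p
    (fun w _ => D.p_mem w) (fun x hx => (D.p_surj x hx).imp fun w h => ⟨Set.mem_univ w, h⟩)
    (fun w _ w' _ => D.factor_reach_iff)
  refine ⟨f, fun I => ?_⟩
  obtain ⟨w, -, h1, h2⟩ := hf I
  rw [h1, h2]
  exact (D.edgeSign_sign σ fun e => D.inl_mem_factor_componentAt).symm

end CircuitExpansion

/-- A function on a finite set whose sums over the fibres of `p` vanish is a coboundary for a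
permutation that is transitive on the fibres of `p`. -/
lemma exists_sub_symm_eq {W : Type*} [Fintype W] [DecidableEq α] (ρ : Equiv.Perm W) (p : W → α)
    (hρ : ∀ w w', p w = p w' → ρ.SameCycle w w') (d : W → ℤ)
    (hd : ∀ w, ∑ v with p v = p w, d v = 0) :
    ∃ g : W → ℤ, ∀ w, g w - g (ρ.symm w) = d w := by
  classical
  rcases isEmpty_or_nonempty W with hW | hW
  · exact ⟨0, fun w => hW.elim w⟩
  let L : (W → ℤ) →ₗ[ℤ] (W → ℤ) := LinearMap.id - LinearMap.funLeft ℤ ℤ ρ.symm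
  have hL : ∀ g w, L g w = g w - g (ρ.symm w) := fun g w => rfl
  suffices h : d ∈ LinearMap.range L by
    obtain ⟨g, hg⟩ := h
    exact ⟨g, fun w => by rw [← hL, hg]⟩
  -- The operator `L` sends `δ w` to `δ w - δ (ρ w)`. Telescoping along a cycle puts every
  -- difference of unit vectors from the same fibre into the range of `L`, and these differences
  -- generate the functions with vanishing fibre sums.
  let δ : W → W → ℤ := fun w => Pi.single w 1
  have h1 : ∀ w, δ w - δ (ρ w) ∈ LinearMap.range L := by
    intro w
    refine ⟨δ w, ?_⟩
    ext v
    rw [hL]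
    simp [δ, Pi.single_apply, Equiv.symm_apply_eq]
  have h2 : ∀ w (n : ℕ), δ w - δ ((ρ ^ n) w) ∈ LinearMap.range L := by
    intro w n
    induction n with
    | zero => simp
    | succ n ih =>
      have := add_mem ih (h1 ((ρ ^ n) w))
      rwa [sub_add_sub_cancel, ← Equiv.Perm.mul_apply, ← pow_succ'] at this
  have h3 : ∀ w w', p w = p w' → δ w - δ w' ∈ LinearMap.range L := by
    intro w w' h
    obtain ⟨n, -, -, hn⟩ := (hρ w w' h).exists_pow_eq''
    rw [← hn]
    exact h2 w n
  -- One representative for every fibre.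
  let r : W → W := fun w => Function.invFun p (p w)
  have hr : ∀ w, p (r w) = p w := fun w => Function.invFun_eq ⟨w, rfl⟩
  have h4 : ∑ w, d w • δ (r w) = 0 := by
    rw [← Finset.sum_fiberwise_of_maps_to (s := Finset.univ) (t := Finset.univ.image p) (g := p)
      (fun w _ => Finset.mem_image_of_mem p (Finset.mem_univ w))]
    refine Finset.sum_eq_zero fun x hx => ?_
    obtain ⟨w, -, rfl⟩ := Finset.mem_image.1 hx
    have : ∀ v ∈ Finset.univ.filter (fun v => p v = p w), d v • δ (r v) = d v • δ (r w) := by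
      intro v hv
      simp only [r, (Finset.mem_filter.1 hv).2]
    rw [Finset.sum_congr rfl this, ← Finset.sum_smul, hd, zero_smul]
  have h5 : d = ∑ w, d w • (δ w - δ (r w)) := by
    simp only [smul_sub, Finset.sum_sub_distrib]
    rw [h4, sub_zero]
    ext v
    simp [δ, Pi.single_apply]
  rw [h5]
  exact sum_mem fun w _ => Submodule.smul_mem _ _ (h3 _ _ (hr w).symm)

/-! ### Flows and contraction of the expanded graph -/

namespace CircuitExpansion

variable {G : Graph α β} {F : Set β} {W : Type*} (D : CircuitExpansion G F W)

open Classical in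
/-- The orientation of the expanded graph that extends the orientation `τ`. -/
noncomputable def orient (τ : β → α → ℤˣ) : β ⊕ (W ⊕ Sym2 W) → W → ℤˣ
  | .inl e, v => τ e (D.p v)
  | .inr (.inl w), v => if v = w then 1 else -1
  | .inr (.inr s), v => if v = (Quot.out s).1 then 1 else -1

/-- A chord is directed away from the first entry of a representative of its unordered pair; either
order of the entries gives opposite signs at the two ends. -/
lemma orient_chord (τ : β → α → ℤˣ) {w : W} (hw : D.lab w = none) :
    D.orient τ (D.third w) w * D.orient τ (D.third w) (D.θ w) = -1 := by
  rw [D.third_of_none hw]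
  have h : s(w, D.θ w) = s((Quot.out s(w, D.θ w)).1, (Quot.out s(w, D.θ w)).2) :=
    (Quot.out_eq s(w, D.θ w)).symm
  rw [Sym2.eq_iff] at h
  have hne := D.θ_ne w
  simp only [orient]
  rcases h with ⟨h1, h2⟩ | ⟨h1, h2⟩
  · rw [← h1, if_pos rfl, if_neg hne, one_mul]
  · rw [← h2, if_pos rfl, if_neg hne.symm, mul_one]

lemma isOrientation (σ : β → ℤˣ) (τ : β → α → ℤˣ) (h : G.IsOrientation σ τ) :
    D.graph.IsOrientation (D.sign σ) (D.orient τ) := by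
  rintro f x y (⟨w, rfl, ⟨rfl, rfl⟩ | ⟨rfl, rfl⟩⟩ | ⟨rfl, rfl⟩)
  · simp [orient, cyc, sign, D.ρ_ne]
  · simp [orient, cyc, sign, D.ρ_ne]
  · cases hx : D.lab x with
    | none =>
      rw [D.orient_chord τ hx, D.third_of_none hx]
      simp [sign]
    | some e =>
      rw [D.third_of_some hx]
      exact h e _ _ (D.isLink x e hx)

lemma third_bijOn (x : α) : Set.BijOn D.third {w | D.p w = x ∧ D.lab w ≠ none}
    (Sum.inl '' G.incidenceSet x) := by
  refine ⟨?_, ?_, ?_⟩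
  · rintro w ⟨rfl, hw⟩
    obtain ⟨e, he⟩ := Option.ne_none_iff_exists'.1 hw
    exact ⟨e, (D.isLink w e he).inc_left, (D.third_of_some he).symm⟩
  · rintro w ⟨rfl, hw⟩ w' ⟨h, hw'⟩ hww
    obtain ⟨e, he⟩ := Option.ne_none_iff_exists'.1 hw
    rw [D.third_of_some he, eq_comm, D.third_eq_inl] at hww
    exact D.lab_inj _ _ e he hww h.symm
  · rintro _ ⟨e, he, rfl⟩
    obtain ⟨w, hw, rfl⟩ := D.exists_lab e x he
    exact ⟨w, ⟨rfl, by simp [hw]⟩, D.third_of_some hw⟩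

/-- The solvability condition for the circuit over `x`: each chord contributes twice with opposite
signs, and the edges of `G` contribute the boundary of `f` at `x`. -/
lemma sum_third_eq_zero [Fintype W] [DecidableEq α] (τ : β → α → ℤˣ) (f : β → ℤ)
    (f' : β ⊕ (W ⊕ Sym2 W) → ℤ) (hf : ∀ e, f' (.inl e) = f e) (hf' : ∀ s, f' (.inr (.inr s)) = 1)
    (x : α) (hx : G.boundary τ f x = 0) :
    ∑ w with D.p w = x, (D.orient τ (D.third w) w : ℤ) * f' (D.third w) = 0 := by
  classical
  rw [← Finset.sum_filter_add_sum_filter_not _ (fun w => D.lab w = none), Finset.filter_filter,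
    Finset.filter_filter]
  have h1 : ∑ w with D.p w = x ∧ D.lab w = none,
      (D.orient τ (D.third w) w : ℤ) * f' (D.third w) = 0 := by
    refine Finset.sum_involution (fun w _ => D.θ w) ?_ (fun w _ _ => D.θ_ne w) ?_
      (fun w _ => D.θ_θ w)
    · intro w hw
      simp only [Finset.mem_filter, Finset.mem_univ, true_and] at hw
      have h := D.orient_chord τ hw.2
      rw [D.third_θ, D.third_of_none hw.2] at *
      rw [hf', mul_one, mul_one]
      rcases Int.units_eq_one_or (D.orient τ (.inr (.inr s(w, D.θ w))) w) with h' | h' <;>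
        rw [h'] at h ⊢
      · rw [one_mul] at h; rw [h]; rfl
      · rw [neg_one_mul, neg_inj] at h; rw [h]; rfl
    · intro w hw
      simp only [Finset.mem_filter, Finset.mem_univ, true_and] at hw ⊢
      exact ⟨(D.p_θ w hw.2).trans hw.1, (D.lab_θ w).trans hw.2⟩
  rw [h1, zero_add, ← hx, boundary]
  have h2 := finsum_mem_image (f := fun g : β ⊕ (W ⊕ Sym2 W) =>
    Sum.elim (fun e => (τ e x : ℤ) * f e) (fun _ => 0) g) (s := G.incidenceSet x)
    (g := (Sum.inl : β → β ⊕ (W ⊕ Sym2 W))) Sum.inl_injective.injOn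
  have h3 := finsum_mem_eq_of_bijOn
    (f := fun w => (D.orient τ (D.third w) w : ℤ) * f' (D.third w))
    (g := fun g : β ⊕ (W ⊕ Sym2 W) => Sum.elim (fun e => (τ e x : ℤ) * f e) (fun _ => 0) g)
    D.third (D.third_bijOn x) (by
      rintro w ⟨rfl, hw⟩
      obtain ⟨e, he⟩ := Option.ne_none_iff_exists'.1 hw
      simp [D.third_of_some he, orient, hf])
  rw [h2] at h3
  simp only [Sum.elim_inl] at h3
  rw [← h3, ← finsum_mem_coe_finset]
  simp

/-- Conservation at `w` prescribes the difference of the values on the two circuit edges at `w`. The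
prescribed differences sum to zero over each fibre, so a solution exists. -/
lemma flowAdmissible [Finite W] {σ : β → ℤˣ} (h : G.FlowAdmissible σ) :
    D.graph.FlowAdmissible (D.sign σ) := by
  classical
  have := Fintype.ofFinite W
  obtain ⟨-, -, τ, f, ⟨hτ, hbd, -⟩, hsupp⟩ := h
  obtain ⟨g, hg⟩ := exists_sub_symm_eq D.ρ D.p D.sameCycle
    (fun w => -((D.orient τ (D.third w) w : ℤ) * Sum.elim f (fun _ => 1) (D.third w))) (by
      intro w
      rw [Finset.sum_neg_distrib, D.sum_third_eq_zero τ f _ (fun _ => rfl) (fun _ => rfl) _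
        (hbd _ (D.p_mem w)), neg_zero])
  -- Adding a constant keeps all differences along the circuits; this one makes every value
  -- positive.
  let K : ℤ := 1 + ∑ w, |g w|
  have hK : ∀ w, 0 < g w + K := by
    intro w
    have h1 : |g w| ≤ ∑ w, |g w| :=
      Finset.single_le_sum (f := fun w => |g w|) (fun w _ => abs_nonneg _) (Finset.mem_univ w)
    have h2 := neg_abs_le (g w)
    simp only [K]
    linarith
  let f' : β ⊕ (W ⊕ Sym2 W) → ℤ := Sum.elim f (Sum.elim (fun w => g w + K) fun _ => 1)
  have hf' : ∀ w, f' (D.third w) = Sum.elim f (fun _ => 1) (D.third w) := by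
    intro w
    cases hw : D.lab w with
    | none => rw [D.third_of_none hw]; rfl
    | some e => rw [D.third_of_some hw]; rfl
  have hfin := D.finite_edgeSet
  -- Any bound above all absolute values will do; the summand `2` gives both `2 ≤ k` and strictness.
  refine ⟨2 + ∑ e ∈ hfin.toFinset, (f' e).natAbs, by omega, D.orient τ, f',
    ⟨D.isOrientation σ τ hτ, ?_, ?_⟩, ?_⟩
  · intro u _
    have hset : D.graph.incidenceSet u =
        (({D.cyc u, D.cyc (D.ρ.symm u), D.third u} : Finset _) : Set _) := by
      rw [incidenceSet_eq]; simp
    rw [boundary, hset, finsum_mem_coe_finset, Finset.sum_insert, Finset.sum_insert,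
      Finset.sum_singleton, hf']
    · have h1 := hg u
      have h2 : D.orient τ (D.cyc u) u = 1 := by simp [orient, cyc]
      have h3 : D.orient τ (D.cyc (D.ρ.symm u)) u = -1 := by
        simp [orient, cyc, (D.ρ_symm_ne u).symm]
      have h4 : ∀ w, f' (D.cyc w) = g w + K := fun w => rfl
      rw [h2, h3, h4, h4]
      push_cast
      linarith
    · simpa using (D.third_ne_cyc _ _).symm
    · simpa using ⟨D.cyc_ne u, (D.third_ne_cyc _ _).symm⟩
  · intro e he
    have h1 : (f' e).natAbs ≤ ∑ e ∈ hfin.toFinset, (f' e).natAbs :=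
      Finset.single_le_sum (f := fun e => (f' e).natAbs) (fun _ _ => Nat.zero_le _)
        (hfin.mem_toFinset.2 he)
    rw [Int.abs_eq_natAbs]
    omega
  · ext e
    refine ⟨fun h => h.1, fun h => ⟨h, ?_⟩⟩
    rcases e with e | w | s
    · have : e ∈ G.flowSupp f := by
        rw [hsupp]
        exact D.inl_mem_edgeSet.1 h
      exact this.2
    · exact (hK w).ne'
    · exact one_ne_zero

/-- The edges of the expanded graph that are not edges of `G`. -/
def newEdges : Set (β ⊕ (W ⊕ Sym2 W)) := E(D.graph) \ Sum.inl '' E(G)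

lemma cyc_mem_newEdges (w : W) : D.cyc w ∈ D.newEdges :=
  ⟨(D.isLink_cyc w).edge_mem, by simp [cyc]⟩

lemma sign_of_mem_newEdges (σ : β → ℤˣ) {f : β ⊕ (W ⊕ Sym2 W)} (hf : f ∈ D.newEdges) :
    D.sign σ f = 1 := by
  rcases f with e | f
  · exact absurd ⟨e, D.inl_mem_edgeSet.1 hf.1, rfl⟩ hf.2
  · rfl

/-- New edges are circuit edges and chords, which stay inside a fibre, and the circuit alone already
connects its fibre. Hence the vertices of the contraction are the fibres of `p`. -/
lemma reach_newEdges_iff [Finite W] {w w' : W} :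
    Relation.ReflTransGen (D.graph.restrict D.newEdges).Adj w w' ↔ D.p w' = D.p w := by
  constructor
  · intro h
    induction h with
    | refl => rfl
    | @tail u v _ h ih =>
      rw [← ih]
      obtain ⟨f, hf, ⟨z, rfl, ⟨rfl, rfl⟩ | ⟨rfl, rfl⟩⟩ | ⟨rfl, rfl⟩⟩ := h
      · exact D.p_ρ _
      · exact (D.p_ρ _).symm
      · cases hu : D.lab u with
        | none => exact D.p_θ u hu
        | some e =>
          rw [D.third_of_some hu] at hf
          exact absurd ⟨e, (D.isLink u e hu).edge_mem, rfl⟩ hf.2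
  · intro h
    obtain ⟨n, -, -, rfl⟩ := (D.sameCycle w w' h.symm).exists_pow_eq''
    clear h
    induction n with
    | zero => exact .refl
    | succ n ih =>
      refine ih.tail ⟨D.cyc ((D.ρ ^ n) w), D.cyc_mem_newEdges _, ?_⟩
      rw [pow_succ', Equiv.Perm.mul_apply]
      exact D.isLink_cyc _

lemma contract_class [Finite W] :
    (fun w => {y | Relation.ReflTransGen (D.graph.restrict D.newEdges).Adj w y}) =
      fun w => {y | D.p y = D.p w} := by
  ext w y
  exact D.reach_newEdges_iff

lemma contract_isLink [Finite W] {e : β} {x y : α} (hx : x ∈ V(G)) (hy : y ∈ V(G)) :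
    (D.graph.contract D.newEdges).IsLink (.inl e) {w | D.p w = x} {w | D.p w = y} ↔
      G.IsLink e x y := by
  have hcl : ∀ w, ∀ x ∈ V(G), {y | D.p y = D.p w} = {y | D.p y = x} → D.p w = x := by
    intro w x hx h
    have : w ∈ {y | D.p y = D.p w} := rfl
    rw [h] at this
    exact this
  rw [contract, contract_class]
  constructor
  · rintro ⟨u, v, h, hu, hv⟩
    rw [deleteEdges_isLink] at h
    rw [← hcl u x hx hu, ← hcl v y hy hv]
    obtain ⟨⟨w, h, -⟩ | ⟨h, rfl⟩, -⟩ := h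
    · simp [cyc] at h
    · exact D.isLink u e (D.third_eq_inl.1 h.symm)
  · intro h
    obtain ⟨w, hw, rfl⟩ := D.exists_lab e x h.inc_left
    obtain rfl := (D.isLink w e hw).right_unique h
    refine ⟨w, D.θ w, ?_, rfl, rfl⟩
    rw [deleteEdges_isLink]
    refine ⟨.inr ⟨(D.third_of_some hw).symm, rfl⟩, fun h' => h'.2 ⟨e, h.edge_mem, rfl⟩⟩

lemma exists_contract_iso [Finite W] (σ : β → ℤˣ) :
    ∃ φ : Iso (D.graph.contract D.newEdges) G, φ.IsSigned (D.sign σ) σ ∧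
      ∀ e, (Sum.inl (φ.edge e : β) : β ⊕ (W ⊕ Sym2 W)) = e := by
  have hV : V(D.graph.contract D.newEdges) = Set.range fun w => {y | D.p y = D.p w} := by
    rw [← Set.image_univ, ← contract_class]
    rfl
  have hE : E(D.graph.contract D.newEdges) = Sum.inl '' E(G) := by
    change E(D.graph) \ (E(D.graph) \ Sum.inl '' E(G)) = _
    rw [Set.sdiff_sdiff_cancel_left]
    rintro _ ⟨e, he, rfl⟩
    exact D.inl_mem_edgeSet.2 he
  let vert : V(G) → V(D.graph.contract D.newEdges) := fun x => ⟨{w | D.p w = x}, by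
    rw [hV]
    obtain ⟨w, hw⟩ := D.p_surj x x.2
    exact ⟨w, by simp only [hw]⟩⟩
  let edge : E(G) → E(D.graph.contract D.newEdges) := fun e => ⟨.inl e, by
    rw [hE]
    exact ⟨e, e.2, rfl⟩⟩
  have hvert : Function.Bijective vert := by
    constructor
    · intro x y h
      obtain ⟨w, hw⟩ := D.p_surj x x.2
      have h : {w | D.p w = x} = {w | D.p w = y} := congrArg Subtype.val h
      have hw' : w ∈ {w | D.p w = x} := hw
      rw [h] at hw'
      exact Subtype.ext (hw.symm.trans hw')
    · rintro ⟨X, hX⟩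
      obtain ⟨w, rfl⟩ := hV ▸ hX
      exact ⟨⟨D.p w, D.p_mem w⟩, rfl⟩
  have hedge : Function.Bijective edge := by
    constructor
    · intro e e' h
      exact Subtype.ext (Sum.inl_injective (congrArg Subtype.val h))
    · rintro ⟨f, hf⟩
      obtain ⟨e, he, rfl⟩ := hE ▸ hf
      exact ⟨⟨e, he⟩, rfl⟩
  let φ : Iso (D.graph.contract D.newEdges) G :=
    { vert := (Equiv.ofBijective vert hvert).symm
      edge := (Equiv.ofBijective edge hedge).symm
      isLink_iff := by
        intro f X Y
        obtain ⟨e, rfl⟩ := hedge.2 f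
        obtain ⟨x, rfl⟩ := hvert.2 X
        obtain ⟨y, rfl⟩ := hvert.2 Y
        rw [Equiv.ofBijective_symm_apply_apply, Equiv.ofBijective_symm_apply_apply,
          Equiv.ofBijective_symm_apply_apply]
        exact (D.contract_isLink x.2 y.2).symm }
  have hφ : ∀ e, (Sum.inl (φ.edge e : β) : β ⊕ (W ⊕ Sym2 W)) = e := by
    intro f
    exact congrArg Subtype.val (Equiv.ofBijective_apply_symm_apply edge hedge f)
  refine ⟨φ, fun C hC _ => D.edgeSign_sign σ fun e => ?_, hφ⟩
  constructor
  · intro he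
    refine ⟨⟨_, IsSubgraph.edgeSet_mono hC he⟩, he, ?_⟩
    exact Sum.inl_injective (hφ _)
  · rintro ⟨f, hf, rfl⟩
    rwa [hφ]

end CircuitExpansion

/-! ### Transition systems -/

/-- Multiplying a permutation by the transposition of two elements in different cycles merges
these cycles. -/
lemma sameCycle_mul_swap {D : Type*} [Finite D] [DecidableEq D] (π : Equiv.Perm D) {a b : D}
    (hab : ¬ π.SameCycle a b) : (π * Equiv.swap a b).SameCycle a b ∧
      ∀ c d, π.SameCycle c d → (π * Equiv.swap a b).SameCycle c d := by
  set π' := π * Equiv.swap a b with hπ'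
  have step : ∀ c, π'.SameCycle c (π' c) := fun c => ⟨1, by simp⟩
  have ha : π' a = π b := by simp [hπ']
  have hb : π' b = π a := by simp [hπ']
  have hc : ∀ c, c ≠ a → c ≠ b → π' c = π c := by
    intro c h1 h2
    simp [hπ', Equiv.swap_apply_of_ne_of_ne h1 h2]
  -- Starting at `π a`, both permutations take the same steps until `a` is reached, because the
  -- `π`-cycle of `a` avoids `b`.
  have h1 : ∀ n : ℕ, π'.SameCycle (π a) ((π ^ (n + 1)) a) ∨ π'.SameCycle (π a) a := by
    intro n
    induction n with
    | zero => left; rw [zero_add, pow_one]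
    | succ n ih =>
      rcases ih with ih | ih
      · by_cases hna : (π ^ (n + 1)) a = a
        · right; rwa [hna] at ih
        · have hnb : (π ^ (n + 1)) a ≠ b := fun h => hab ⟨((n + 1 : ℕ) : ℤ), by rwa [zpow_natCast]⟩
          left
          have := step ((π ^ (n + 1)) a)
          rw [hc _ hna hnb, ← Equiv.Perm.mul_apply, ← pow_succ'] at this
          exact ih.trans this
      · exact .inr ih
  have h2 : π'.SameCycle (π a) a := by
    obtain ⟨n, hn, -, h⟩ := (Equiv.Perm.SameCycle.refl π a).exists_pow_eq''
    rcases h1 (n - 1) with h' | h'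
    · rwa [Nat.sub_add_cancel hn, h] at h'
    · exact h'
  have h3 : π'.SameCycle a b := by
    have := step b
    rw [hb] at this
    exact (this.trans h2).symm
  have h4 : ∀ c, π'.SameCycle c (π c) := by
    intro c
    by_cases hca : c = a
    · rw [hca]; exact h2.symm
    by_cases hcb : c = b
    · rw [hcb]
      have := step a
      rw [ha] at this
      exact h3.symm.trans this
    have := step c
    rwa [hc c hca hcb] at this
  refine ⟨h3, fun c d hcd => ?_⟩
  obtain ⟨n, -, -, rfl⟩ := hcd.exists_pow_eq''
  clear hcd
  induction n with
  | zero => rfl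
  | succ n ih =>
    rw [pow_succ', Equiv.Perm.mul_apply]
    exact ih.trans (h4 _)

/-- Every system of transitions from the arcs entering a vertex to those leaving it can be chosen
such that all arcs at the same vertex are in the same cycle. -/
lemma exists_perm_sameCycle {D V : Type*} [Finite D] (hd tl : D → V) (π₀ : Equiv.Perm D)
    (h₀ : ∀ d, tl (π₀ d) = hd d) : ∃ π : Equiv.Perm D, (∀ d, tl (π d) = hd d) ∧
      ∀ d d', hd d = hd d' → π.SameCycle d d' := by
  classical
  have : Nonempty {π : Equiv.Perm D // ∀ d, tl (π d) = hd d} := ⟨⟨π₀, h₀⟩⟩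
  -- Maximize the number of pairs of arcs in a common cycle. If two arcs with the same head lay in
  -- different cycles, exchanging their successors would be admissible and would merge the cycles.
  obtain ⟨⟨π, hπ⟩, hmax⟩ := Finite.exists_max
    fun π : {π : Equiv.Perm D // ∀ d, tl (π d) = hd d} => {q : D × D | π.1.SameCycle q.1 q.2}.ncard
  refine ⟨π, hπ, fun a b hab => ?_⟩
  by_contra hn
  obtain ⟨h1, h2⟩ := sameCycle_mul_swap π hn
  have h3 : ∀ d, tl ((π * Equiv.swap a b) d) = hd d := by
    intro d
    rw [Equiv.Perm.mul_apply, hπ]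
    by_cases hda : d = a
    · rw [hda, Equiv.swap_apply_left, hab]
    by_cases hdb : d = b
    · rw [hdb, Equiv.swap_apply_right, hab]
    rw [Equiv.swap_apply_of_ne_of_ne hda hdb]
  refine absurd (hmax ⟨_, h3⟩) (not_le.2 (Set.ncard_lt_ncard ?_ (Set.toFinite _)))
  refine Set.ssubset_iff_subset_ne.2 ⟨fun q hq => h2 _ _ hq, fun h => hn ?_⟩
  have : (a, b) ∈ {q : D × D | (π * Equiv.swap a b).SameCycle q.1 q.2} := h1
  rw [← h] at this
  exact this

/-- At each vertex, match the entering with the leaving arcs arbitrarily. -/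
lemma exists_perm_of_card_fiber_eq {D V : Type*} [Finite D] (hd tl : D → V)
    (h : ∀ x, Nat.card {d // hd d = x} = Nat.card {d // tl d = x}) :
    ∃ π : Equiv.Perm D, ∀ d, tl (π d) = hd d := by
  have e : ∀ x, Nonempty ({d // hd d = x} ≃ {d // tl d = x}) := fun x => Finite.card_eq.1 (h x)
  let e := fun x => (e x).some
  refine ⟨(Equiv.sigmaFiberEquiv hd).symm.trans
    ((Equiv.sigmaCongrRight e).trans (Equiv.sigmaFiberEquiv tl)), fun d => ?_⟩
  exact (e (hd d) ⟨d, rfl⟩).2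

/-- The arcs of a `2`-flow: every edge of its support is directed such that as many edges enter as
leave a vertex. -/
lemma exists_arcs {G : Graph α β} (hE : E(G).Finite) (hG : G.Loopless) {τ : β → α → ℤˣ} {f : β → ℤ}
    (h : G.IsFlow (fun _ => 1) 2 τ f) :
    ∃ hd tl : G.flowSupp f → α, (∀ e : G.flowSupp f, G.IsLink e (tl e) (hd e)) ∧
      ∀ x, Nat.card {e // hd e = x} = Nat.card {e // tl e = x} := by
  classical
  have h1 : ∀ e : G.flowSupp f, ∃ x y, G.IsLink e x y ∧ (τ e x : ℤ) * f e = 1 ∧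
      (τ e y : ℤ) * f e = -1 := by
    rintro ⟨e, he, hf⟩
    obtain ⟨x, y, hl⟩ := exists_isLink_of_mem_edgeSet he
    have hτ := h.isOrientation e x y hl
    have habs := h.abs_lt e he
    have hf' : f e = 1 ∨ f e = -1 := by
      simp only [ne_eq] at hf
      push_cast at habs
      rw [abs_lt] at habs
      omega
    have hτ' : (τ e x = 1 ∧ τ e y = -1) ∨ (τ e x = -1 ∧ τ e y = 1) := by
      rcases Int.units_eq_one_or (τ e x) with h' | h' <;> rw [h'] at hτ ⊢
      · left; simpa using hτ
      · right; simpa using hτ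
    rcases hf' with hf' | hf' <;> rcases hτ' with ⟨h2, h3⟩ | ⟨h2, h3⟩
    · exact ⟨x, y, hl, by simp [h2, hf'], by simp [h3, hf']⟩
    · exact ⟨y, x, hl.symm, by simp [h3, hf'], by simp [h2, hf']⟩
    · exact ⟨y, x, hl.symm, by simp [h3, hf'], by simp [h2, hf']⟩
    · exact ⟨x, y, hl, by simp [h2, hf'], by simp [h3, hf']⟩
  choose tl hd hl htl hhd using h1
  have hfin : Finite (G.flowSupp f) := hE.subset fun e he => he.1
  have := Fintype.ofFinite (G.flowSupp f)
  refine ⟨hd, tl, hl, fun x => ?_⟩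
  by_cases hx : x ∈ V(G)
  · have hb := h.boundary_eq_zero x hx
    -- Each arc contributes `1` at its tail and `-1` at its head, so the boundary is the out-degree
    -- minus the in-degree.
    have h2 : G.boundary τ f x = ∑ e : G.flowSupp f,
        ((if tl e = x then 1 else 0) - (if hd e = x then 1 else 0)) := by
      rw [boundary, finsum_mem_def, ← finsum_eq_sum_of_fintype]
      have h3 : ∀ e : G.flowSupp f, ((if tl e = x then 1 else 0) - (if hd e = x then 1 else 0)) =
          (G.incidenceSet x).indicator (fun e => (τ e x : ℤ) * f e) e := by
        intro e
        have hne : tl e ≠ hd e := (hl e).ne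
        by_cases htx : tl e = x
        · rw [if_pos htx, if_neg (htx ▸ hne.symm), Set.indicator_of_mem, ← htx, htl]
          · rfl
          · rw [mem_incidenceSet, ← htx]; exact (hl e).inc_left
        by_cases hhx : hd e = x
        · rw [if_neg htx, if_pos hhx, Set.indicator_of_mem, ← hhx, hhd]
          · rfl
          · rw [mem_incidenceSet, ← hhx]; exact (hl e).inc_right
        rw [if_neg htx, if_neg hhx, Set.indicator_of_notMem]
        · rfl
        · intro hi
          rcases Inc.eq_or_eq_of_isLink hi (hl e) with h' | h'
          exacts [htx h'.symm, hhx h'.symm]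
      simp_rw [h3]
      rw [finsum_set_coe_eq_finsum_mem, finsum_mem_def]
      refine finsum_congr fun e => ?_
      by_cases he : e ∈ G.flowSupp f
      · rw [Set.indicator_of_mem he]
      · rw [Set.indicator_of_notMem he]
        by_cases hi : e ∈ G.incidenceSet x
        · have : f e = 0 := by
            by_contra hf
            exact he ⟨Inc.edge_mem hi, hf⟩
          rw [Set.indicator_of_mem hi, this, mul_zero]
        · rw [Set.indicator_of_notMem hi]
    rw [hb, Finset.sum_sub_distrib, Finset.sum_boole, Finset.sum_boole] at h2
    rw [Nat.card_eq_fintype_card, Nat.card_eq_fintype_card, Fintype.card_subtype,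
      Fintype.card_subtype]
    omega
  · have h3 : IsEmpty {e // hd e = x} := ⟨fun e => hx (e.2 ▸ (hl e).right_mem)⟩
    have h4 : IsEmpty {e // tl e = x} := ⟨fun e => hx (e.2 ▸ (hl e).left_mem)⟩
    simp

/-- The edges in `F` as arcs, together with one arc from every vertex to itself, and transitions
from the arcs entering a vertex to those leaving it that connect all arcs at a vertex. -/
structure TransitionSystem (G : Graph α β) (F : Set β) (D : Type*) where
  hd : D → α
  tl : D → α
  lab : D → Option β
  π : Equiv.Perm D
  hd_mem : ∀ d, hd d ∈ V(G)
  hd_surj : ∀ x ∈ V(G), ∃ d, hd d = x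
  mem_of_lab : ∀ d e, lab d = some e → e ∈ F
  isLink : ∀ d e, lab d = some e → G.IsLink e (tl d) (hd d)
  tl_eq_hd : ∀ d, lab d = none → tl d = hd d
  exists_lab : ∀ e ∈ F, ∃ d, lab d = some e
  lab_inj : ∀ d d' e, lab d = some e → lab d' = some e → d = d'
  tl_π : ∀ d, tl (π d) = hd d
  sameCycle : ∀ d d', hd d = hd d' → π.SameCycle d d'

lemma exists_transitionSystem {α : Type u} {β : Type v} {G : Graph α β} (hV : V(G).Finite)
    (hE : E(G).Finite) (hG : G.Loopless) {τ : β → α → ℤˣ} {f : β → ℤ}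
    (h : G.IsFlow (fun _ => 1) 2 τ f) :
    ∃ D : Type u, Finite D ∧ Nonempty (TransitionSystem G (G.flowSupp f) D) := by
  obtain ⟨hd, tl, hl, hcard⟩ := exists_arcs hE hG h
  have : Finite (G.flowSupp f) := hE.subset fun e he => he.1
  have : Finite V(G) := hV
  obtain ⟨π₁, hπ₁⟩ := exists_perm_of_card_fiber_eq hd tl hcard
  obtain ⟨n, ⟨ε'⟩⟩ := Finite.exists_equiv_fin (G.flowSupp f ⊕ V(G))
  -- The arcs are renamed by a finite type in the universe of the vertices, since the edges may live
  -- in another one.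
  let ε : ULift.{u} (Fin n) ≃ G.flowSupp f ⊕ V(G) := Equiv.ulift.trans ε'.symm
  let hd' : G.flowSupp f ⊕ V(G) → α := Sum.elim hd Subtype.val
  let tl' : G.flowSupp f ⊕ V(G) → α := Sum.elim tl Subtype.val
  let lab : G.flowSupp f ⊕ V(G) → Option β := Sum.elim (fun e => some e.1) fun _ => none
  obtain ⟨π, hπ, hcyc⟩ := exists_perm_sameCycle (hd' ∘ ε) (tl' ∘ ε)
    (ε.trans ((Equiv.sumCongr π₁ (Equiv.refl _)).trans ε.symm)) (by
      intro d
      generalize hz : ε d = z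
      rcases z with e | x
      · simpa [hd', tl', hz] using hπ₁ e
      · simp [hd', tl', hz])
  have hlab : ∀ z e, lab z = some e → e ∈ G.flowSupp f ∧ G.IsLink e (tl' z) (hd' z) := by
    rintro (e' | x) e he
    · obtain rfl : e'.1 = e := by simpa [lab] using he
      exact ⟨e'.2, hl e'⟩
    · simp [lab] at he
  have hinj : ∀ z z' e, lab z = some e → lab z' = some e → z = z' := by
    rintro (a | x) (b | y) e he he'
    · obtain rfl : a.1 = e := by simpa [lab] using he
      have : b.1 = a.1 := by simpa [lab] using he'
      rw [Subtype.ext this]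
    all_goals simp [lab] at he he'
  exact ⟨ULift.{u} (Fin n), inferInstance, ⟨
    { hd := hd' ∘ ε
      tl := tl' ∘ ε
      lab := lab ∘ ε
      π := π
      hd_mem := by
        intro d
        rw [Function.comp_apply]
        rcases ε d with e | x
        exacts [(hl e).right_mem, x.2]
      hd_surj := fun x hx => ⟨ε.symm (.inr ⟨x, hx⟩), by simp [hd']⟩
      mem_of_lab := fun d e he => (hlab _ e he).1
      isLink := fun d e he => (hlab _ e he).2
      tl_eq_hd := by
        intro d he
        rw [Function.comp_apply] at he ⊢
        rw [Function.comp_apply]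
        generalize ε d = z at *
        rcases z with e | x
        · simp [lab] at he
        · rfl
      exists_lab := fun e he => ⟨ε.symm (.inl ⟨e, he⟩), by simp [lab]⟩
      lab_inj := fun d d' e he he' => ε.injective (hinj _ _ e he he')
      tl_π := hπ
      sameCycle := hcyc }⟩⟩

/-- The support of a `2`-flow has even degrees. -/
lemma sum_flowSupp_eq_zero {G : Graph α β} {f : β → ℤ} {τ : β → α → ℤˣ}
    {σ : β → ℤˣ} (h : G.IsFlow σ 2 τ f) {x : α} (hx : x ∈ V(G)) (hE : (G.incidenceSet x).Finite) :
    ∑ e ∈ hE.toFinset, ((f e : ℤ) : ZMod 2) = 0 := by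
  have hb := h.boundary_eq_zero x hx
  rw [boundary, finsum_mem_eq_finite_toFinset_sum _ hE] at hb
  have := congrArg (Int.cast : ℤ → ZMod 2) hb
  rw [Int.cast_sum, Int.cast_zero] at this
  rw [← this]
  refine Finset.sum_congr rfl fun e _ => ?_
  rcases Int.units_eq_one_or (τ e x) with h' | h' <;> simp [h']

/-- The number of edges at a vertex outside the transition system has the same parity as the
number of transitions at that vertex between arcs on which a second flow has different parities. -/
lemma TransitionSystem.sum_parity {G : Graph α β} {F : Set β} {D : Type*} [Fintype D]
    [DecidableEq α] (T : TransitionSystem G F D) (hE : E(G).Finite) (hG : G.Loopless)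
    {τ : β → α → ℤˣ} {f : β → ℤ} {σ : β → ℤˣ} (h : G.IsFlow σ 2 τ f)
    (hF : ∀ e ∈ E(G), e ∉ F → f e ≠ 0) (col : D → ZMod 2)
    (hcol : ∀ d e, T.lab d = some e → col d = f e) (hcol' : ∀ d, T.lab d = none → col d = 0)
    {x : α} (hx : x ∈ V(G)) :
    ∑ d with T.hd d = x, (col d + col (T.π d)) =
      (Nat.card {e // (e ∈ E(G) ∧ e ∉ F) ∧ G.Inc e x} : ZMod 2) := by
  classical
  have hI : (G.incidenceSet x).Finite := hE.subset (G.incidenceSet_subset_edgeSet x)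
  have h1 : ∑ d with T.hd d = x, col (T.π d) = ∑ d with T.tl d = x, col d :=
    Finset.sum_equiv T.π (by simp [T.tl_π]) (fun _ _ => rfl)
  -- An arc that comes from an edge has distinct ends, so it is counted at most once on each side; a
  -- dummy arc has `col d = 0`.
  have h2 : ∑ d with T.lab d ≠ none ∧ (T.hd d = x ∨ T.tl d = x), col d =
      ∑ d with T.hd d = x, col d + ∑ d with T.tl d = x, col d := by
    rw [Finset.sum_filter, Finset.sum_filter, Finset.sum_filter, ← Finset.sum_add_distrib]
    refine Finset.sum_congr rfl fun d _ => ?_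
    cases hd : T.lab d with
    | none => simp [hcol' d hd]
    | some e =>
      have hne : T.tl d ≠ T.hd d := (T.isLink d e hd).ne
      by_cases h3 : T.hd d = x
      · have h4 : T.tl d ≠ x := h3 ▸ hne
        simp [h3, h4]
      · simp [h3]
  have h3 : ∑ e ∈ hI.toFinset with e ∈ F, ((f e : ℤ) : ZMod 2) =
      ∑ d with T.lab d ≠ none ∧ (T.hd d = x ∨ T.tl d = x), col d := by
    have hch : ∀ e ∈ hI.toFinset.filter (· ∈ F), ∃ d, T.lab d = some e := fun e he =>
      T.exists_lab e (Finset.mem_filter.1 he).2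
    choose dart hdart using hch
    refine Finset.sum_bij dart ?_ ?_ ?_ ?_
    · intro e he
      have hinc : G.Inc e x := by simpa using (Finset.mem_filter.1 he).1
      have hl := T.isLink _ e (hdart e he)
      simp only [Finset.mem_filter, Finset.mem_univ, true_and, hdart e he]
      refine ⟨by simp, ?_⟩
      rcases hinc.eq_or_eq_of_isLink hl with h | h
      exacts [.inr h.symm, .inl h.symm]
    · intro e he e' he' hee
      have := hdart e he
      rw [hee, hdart e' he'] at this
      exact (Option.some.inj this).symm
    · intro d hd
      simp only [Finset.mem_filter, Finset.mem_univ, true_and] at hd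
      obtain ⟨e, he⟩ := Option.ne_none_iff_exists'.1 hd.1
      have hmem : e ∈ hI.toFinset.filter (· ∈ F) := by
        refine Finset.mem_filter.2 ⟨?_, T.mem_of_lab d e he⟩
        rw [Set.Finite.mem_toFinset, mem_incidenceSet]
        rcases hd.2 with h | h
        · exact h ▸ (T.isLink d e he).inc_right
        · exact h ▸ (T.isLink d e he).inc_left
      exact ⟨e, hmem, T.lab_inj _ _ e (hdart e hmem) he⟩
    · intro e he
      rw [hcol _ e (hdart e he)]
  have h4 : ∑ e ∈ hI.toFinset with e ∉ F, ((f e : ℤ) : ZMod 2) =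
      (Nat.card {e // (e ∈ E(G) ∧ e ∉ F) ∧ G.Inc e x} : ZMod 2) := by
    have h5 : ∀ e ∈ hI.toFinset.filter (· ∉ F), ((f e : ℤ) : ZMod 2) = 1 := by
      intro e he
      obtain ⟨he, heF⟩ := Finset.mem_filter.1 he
      have heE : e ∈ E(G) := by
        have : G.Inc e x := by simpa using he
        exact this.edge_mem
      have h6 := hF e heE heF
      have h7 := h.abs_lt e heE
      push_cast at h7
      rw [abs_lt] at h7
      have h8 : f e = 1 ∨ f e = -1 := by omega
      rcases h8 with h8 | h8 <;> rw [h8] <;> rfl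
    rw [Finset.sum_congr rfl h5, Finset.sum_const, nsmul_one]
    congr 1
    refine (Nat.subtype_card _ fun e => ?_).symm
    rw [Finset.mem_filter, Set.Finite.mem_toFinset, mem_incidenceSet]
    exact ⟨fun ⟨h, h'⟩ => ⟨⟨h.edge_mem, h'⟩, h⟩, fun ⟨⟨_, h'⟩, h⟩ => ⟨h, h'⟩⟩
  -- Split the even sum of `f₂` at `x` into the edges inside and outside `F`; modulo `2` the two
  -- parts are equal.
  have h6 := sum_flowSupp_eq_zero h hx hI
  rw [← Finset.sum_filter_add_sum_filter_not _ (· ∈ F), h3, h2, h4] at h6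
  rw [Finset.sum_add_distrib, h1]
  rw [add_eq_zero_iff_eq_neg, ZMod.neg_eq_self_mod_two] at h6
  exact h6

/-! ### Attaching the edges outside the first support -/

lemma exists_injective_and_involution {A B : Type*} [Finite A] [Finite B]
    (hle : Nat.card A ≤ Nat.card B) (heven : Even (Nat.card A + Nat.card B)) :
    ∃ (j : A → B) (i : B → B), Function.Injective j ∧ (∀ b, i (i b) = b) ∧
      ∀ b, b ∉ Set.range j → i b ≠ b ∧ i b ∉ Set.range j := by
  obtain ⟨k, hk⟩ : ∃ k, Nat.card B = Nat.card A + (k + k) := by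
    obtain ⟨m, hm⟩ := heven
    exact ⟨m - Nat.card A, by omega⟩
  -- Outside the image of `A` an even number of elements remains; the involution swaps two halves of
  -- them and fixes the image.
  obtain ⟨ε⟩ : Nonempty (B ≃ A ⊕ (Fin k ⊕ Fin k)) := by
    rw [← Finite.card_eq]
    simp [Nat.card_sum, hk]
  refine ⟨fun a => ε.symm (.inl a), fun b => ε.symm (Sum.map id Sum.swap (ε b)),
    ε.symm.injective.comp Sum.inl_injective, fun b => ?_, fun b hb => ?_⟩
  · simp
  · rcases hz : ε b with a | z
    · exact absurd ⟨a, by simp [← hz]⟩ hb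
    · constructor
      · intro h
        have h : Sum.map id Sum.swap (ε b) = ε b := by simpa using congrArg ε h
        rw [hz] at h
        rcases z with z | z <;> simp at h
      · rintro ⟨a, h⟩
        have h : Sum.inl a = Sum.map id Sum.swap (ε b) := ε.symm.injective h
        simp [hz] at h

/-- If `M` has enough elements over every vertex, and as many modulo `2` as there are edges in
`C` at that vertex, then the ends of these edges can be attached to elements of `M`, and the other
elements over that vertex can be paired. -/
lemma exists_attachment {G : Graph α β} (hG : G.Loopless) {M : Type*} [Finite M] (p : M → α)
    (C : Set β) (hC : C.Finite)
    (hle : ∀ x, Nat.card {e // e ∈ C ∧ G.Inc e x} ≤ Nat.card {m // p m = x})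
    (heven : ∀ x, Even (Nat.card {e // e ∈ C ∧ G.Inc e x} + Nat.card {m // p m = x})) :
    ∃ (θ : M → M) (lab : M → Option β), (∀ m, θ (θ m) = m) ∧ (∀ m, θ m ≠ m) ∧
      (∀ m, lab (θ m) = lab m) ∧ (∀ m e, lab m = some e → e ∈ C ∧ G.IsLink e (p m) (p (θ m))) ∧
      (∀ m, lab m = none → p (θ m) = p m) ∧
      (∀ e x, e ∈ C → G.Inc e x → ∃ m, lab m = some e ∧ p m = x) ∧
      ∀ m m' e, lab m = some e → lab m' = some e → p m = p m' → m = m' := by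
  have hfin : ∀ x, Finite {e // e ∈ C ∧ G.Inc e x} := fun x => hC.subset fun e he => he.1
  choose j i hj hi hi' using fun x => exists_injective_and_involution (hle x) (heven x)
  have hpj : ∀ x a, p (j x a : M) = x := fun x a => (j x a).2
  have hji : ∀ x a x' a', (j x a : M) = j x' a' → x = x' ∧ a.1 = a'.1 := by
    intro x a x' a' h
    obtain rfl : x = x' := by rw [← hpj x a, h, hpj]
    exact ⟨rfl, congrArg Subtype.val (hj x (Subtype.ext h))⟩
  -- The pairing of the elements that receive no end of an edge in `C`, glued together from the
  -- fibres.
  let ι : M → M := fun m => i (p m) ⟨m, rfl⟩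
  have hι : ∀ x m (h : p m = x), ι m = i x ⟨m, h⟩ := by
    rintro x m rfl
    rfl
  have hpι : ∀ m, p (ι m) = p m := fun m => (i (p m) ⟨m, rfl⟩).2
  have hιι : ∀ m, ι (ι m) = m := by
    intro m
    rw [hι (p m) (ι m) (hpι m)]
    exact congrArg Subtype.val (hi (p m) ⟨m, rfl⟩)
  let T : Set M := {m | ∃ x, ∃ a, (j x a : M) = m}
  have hιT : ∀ m, m ∉ T → ι m ≠ m ∧ ι m ∉ T := by
    intro m hm
    obtain ⟨h1, h2⟩ := hi' (p m) ⟨m, rfl⟩ (by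
      rintro ⟨a, ha⟩
      exact hm ⟨_, a, congrArg Subtype.val ha⟩)
    refine ⟨fun h => h1 (Subtype.ext h), ?_⟩
    rintro ⟨x, a, h⟩
    obtain rfl : x = p m := by rw [← hpj x a, h, hpι]
    exact h2 ⟨a, Subtype.ext h⟩
  have hex : ∀ m, ∃ (m' : M) (o : Option β), (∃ x y e, ∃ (hx : e ∈ C ∧ G.Inc e x)
      (hy : e ∈ C ∧ G.Inc e y), G.IsLink e x y ∧ m = (j x ⟨e, hx⟩ : M) ∧
      m' = (j y ⟨e, hy⟩ : M) ∧ o = some e) ∨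
      (m ∉ T ∧ m' = ι m ∧ o = none) := by
    intro m
    by_cases hm : m ∈ T
    · obtain ⟨x, ⟨e, heC, y, hl⟩, rfl⟩ := hm
      exact ⟨j y ⟨e, heC, hl.inc_right⟩, some e, .inl ⟨x, y, e, ⟨heC, y, hl⟩, _, hl, rfl, rfl, rfl⟩⟩
    · exact ⟨ι m, none, .inr ⟨hm, rfl, rfl⟩⟩
  choose θ lab hspec using hex
  have hj' : ∀ x y e (hx : e ∈ C ∧ G.Inc e x) (hy : e ∈ C ∧ G.Inc e y), G.IsLink e x y →
      θ (j x ⟨e, hx⟩) = j y ⟨e, hy⟩ ∧ lab (j x ⟨e, hx⟩) = some e := by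
    intro x y e hx hy hl
    rcases hspec (j x ⟨e, hx⟩) with ⟨x', y', e', hx', hy', hl', h1, h2, h3⟩ | ⟨h, -⟩
    · obtain ⟨rfl, rfl⟩ := hji _ _ _ _ h1
      obtain rfl := hl.right_unique hl'
      exact ⟨h2, h3⟩
    · exact absurd ⟨x, _, rfl⟩ h
  have hι' : ∀ m, m ∉ T → θ m = ι m ∧ lab m = none := by
    intro m hm
    rcases hspec m with ⟨x', y', e', hx', hy', hl', h1, h2, h3⟩ | ⟨-, h⟩
    · exact absurd ⟨_, _, h1.symm⟩ hm
    · exact h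
  have hlab : ∀ m e, lab m = some e → ∃ x y, ∃ (hx : e ∈ C ∧ G.Inc e x)
      (hy : e ∈ C ∧ G.Inc e y), G.IsLink e x y ∧ m = (j x ⟨e, hx⟩ : M) ∧
      θ m = (j y ⟨e, hy⟩ : M) := by
    intro m e he
    rcases hspec m with ⟨x', y', e', hx', hy', hl', h1, h2, h3⟩ | ⟨-, -, h⟩
    · obtain rfl : e = e' := by simpa [he] using h3
      exact ⟨x', y', hx', hy', hl', h1, h2⟩
    · simp [he] at h
  refine ⟨θ, lab, ?_, ?_, ?_, ?_, ?_, ?_, ?_⟩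
  · intro m
    rcases hspec m with ⟨x, y, e, hx, hy, hl, h1, h2, -⟩ | ⟨h, h1, -⟩
    · rw [h2, (hj' y x e hy hx hl.symm).1, h1]
    · rw [h1, (hι' _ (hιT m h).2).1, hιι]
  · intro m
    rcases hspec m with ⟨x, y, e, hx, hy, hl, h1, h2, -⟩ | ⟨h, h1, -⟩
    · rw [h2, h1]
      intro h
      exact hl.ne (hji _ _ _ _ h).1.symm
    · rw [h1]
      exact (hιT m h).1
  · intro m
    rcases hspec m with ⟨x, y, e, hx, hy, hl, h1, h2, h3⟩ | ⟨h, h1, h3⟩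
    · rw [h2, (hj' y x e hy hx hl.symm).2, h3]
    · rw [h1, (hι' _ (hιT m h).2).2, h3]
  · intro m e he
    obtain ⟨x, y, hx, hy, hl, h1, h2⟩ := hlab m e he
    rw [h2, h1, hpj, hpj]
    exact ⟨hx.1, hl⟩
  · intro m hm
    rcases hspec m with ⟨x, y, e, hx, hy, hl, h1, h2, h3⟩ | ⟨h, h1, h3⟩
    · simp [hm] at h3
    · rw [h1, hpι]
  · rintro e x heC ⟨y, hl⟩
    exact ⟨j x ⟨e, heC, y, hl⟩, (hj' x y e _ ⟨heC, hl.inc_right⟩ hl).2, hpj _ _⟩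
  · intro m m' e he he' hp
    obtain ⟨x, y, hx, hy, hl, h1, -⟩ := hlab m e he
    obtain ⟨x', y', hx', hy', hl', h1', -⟩ := hlab m' e he'
    rw [h1, h1', hpj, hpj] at hp
    subst hp
    rw [h1, h1']

/-! ### Expansion along a transition system -/

section Blocks

variable {D : Type*} {n : D → ℕ}

/-- The vertices of the expanded graph: every transition `d` gives a path, which starts at the head
of the arc `d`, has `n d` inner vertices and ends at the tail of the next arc. -/
inductive BlockVertex (D : Type*) (n : D → ℕ)
  | first (d : D)
  | mid (m : Σ d, Fin (n d))
  | last (d : D)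

namespace BlockVertex

instance [Finite D] : Finite (BlockVertex D n) := by
  refine Finite.of_injective (β := D ⊕ ((Σ d, Fin (n d)) ⊕ D)) (fun w => match w with
    | first d => .inl d
    | mid m => .inr (.inl m)
    | last d => .inr (.inr d)) ?_
  rintro (d | m | d) (d' | m' | d') h <;> simp_all

/-- The path that contains a vertex. -/
def block : BlockVertex D n → D
  | first d => d
  | mid m => m.1
  | last d => d

/-- The next vertex along the paths, where the path of `d` is followed by that of `ζ d`. -/
def next (hn : ∀ d, 0 < n d) (ζ : D → D) : BlockVertex D n → BlockVertex D n
  | first d => mid ⟨d, 0, hn d⟩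
  | mid m => if h : m.2 + 1 < n m.1 then mid ⟨m.1, m.2 + 1, h⟩ else last m.1
  | last d => first (ζ d)

variable {hn : ∀ d, 0 < n d}

lemma next_injective {ζ : D → D} (hζ : Function.Injective ζ) :
    Function.Injective (next hn ζ) := by
  rintro (d | ⟨d, i, hi⟩ | d) (d' | ⟨d', i', hi'⟩ | d') h
  · simp only [next, mid.injEq, Sigma.mk.injEq] at h
    rw [h.1]
  · simp only [next] at h
    split_ifs at h
    simp only [mid.injEq, Sigma.mk.injEq] at h
    obtain ⟨rfl, h⟩ := h
    simp at h
  · simp [next] at h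
  · simp only [next] at h
    split_ifs at h
    simp only [mid.injEq, Sigma.mk.injEq] at h
    obtain ⟨rfl, h⟩ := h
    simp at h
  · simp only [next] at h
    split_ifs at h with h1 h2 h2
    · simp only [mid.injEq, Sigma.mk.injEq] at h
      obtain ⟨rfl, h⟩ := h
      simpa using h
    · simp only [last.injEq] at h
      subst h
      have : i = i' := by omega
      subst this
      rfl
  · simp only [next] at h
    split_ifs at h
  · simp [next] at h
  · simp only [next] at h
    split_ifs at h
  · simp only [next, first.injEq] at h
    rw [hζ h]

/-- An equivalence relation that contains consecutive vertices of the paths and the last vertex of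
the path of `d` with the first vertex of the path of `ψ d` contains any two vertices in paths of the
same cycle of `ψ`. -/
lemma rel_of_sameCycle [Finite D] {R : BlockVertex D n → BlockVertex D n → Prop}
    (hR : Equivalence R) (ψ : Equiv.Perm D) (hfirst : ∀ d, R (first d) (next hn ψ (first d)))
    (hmid : ∀ m, R (mid m) (next hn ψ (mid m))) (hlast : ∀ d, R (last d) (first (ψ d)))
    {w w' : BlockVertex D n} (h : ψ.SameCycle w.block w'.block) : R w w' := by
  have h1 : ∀ d i (hi : i < n d), R (first d) (mid ⟨d, i, hi⟩) := by
    intro d i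
    induction i with
    | zero => exact fun _ => hfirst d
    | succ i ih =>
      intro hi
      have := hmid ⟨d, i, by omega⟩
      rw [next, dif_pos hi] at this
      exact hR.trans (ih (by omega)) this
  have h2 : ∀ d, R (first d) (last d) := by
    intro d
    have hd := hn d
    have := hmid ⟨d, n d - 1, by omega⟩
    rw [next, dif_neg (by simp only; omega)] at this
    exact hR.trans (h1 d _ _) this
  have h3 : ∀ w : BlockVertex D n, R (first w.block) w := by
    rintro (d | ⟨d, i, hi⟩ | d)
    exacts [hR.refl _, h1 d i hi, h2 d]
  have h4 : ∀ k : ℕ, ∀ d, R (first d) (first ((ψ ^ k) d)) := by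
    intro k d
    induction k with
    | zero => exact hR.refl _
    | succ k ih =>
      rw [pow_succ', Equiv.Perm.mul_apply]
      exact hR.trans ih (hR.trans (h2 _) (hlast _))
  obtain ⟨k, -, -, hk⟩ := h.exists_pow_eq''
  refine hR.trans (hR.symm (h3 w)) (hR.trans ?_ (h3 w'))
  rw [← hk]
  exact h4 k _

end BlockVertex

/-- The color of an edge on the circuits of the `2`-factor. -/
def bitColor (z : ZMod 2) : Fin 3 := if z = 0 then 0 else 1

lemma bitColor_ne_two (z : ZMod 2) : bitColor z ≠ 2 := by
  unfold bitColor
  split_ifs <;> decide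

lemma bitColor_add_one_ne (z : ZMod 2) : bitColor (z + 1) ≠ bitColor z := by
  revert z
  decide

end Blocks

-- The last vertex of the path of `d` is joined to the first vertex of the path of `T.π d` by the
-- arc `T.π d`. So the paths together with these third edges trace out the closed trails, whereas
-- the circuit over a vertex runs through all paths at that vertex in the order given by `ζ`.
open BlockVertex in
lemma TransitionSystem.exists_circuitExpansion {G : Graph α β} {F : Set β} {D : Type u} [Fintype D]
    [DecidableEq α] (T : TransitionSystem G F D) (hE : E(G).Finite) (hG : G.Loopless)
    (col : D → ZMod 2) (hcol : ∀ x ∈ V(G), ∑ d with T.hd d = x, (col d + col (T.π d)) =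
      (Nat.card {e // (e ∈ E(G) ∧ e ∉ F) ∧ G.Inc e x} : ZMod 2)) :
    ∃ W : Type u, Finite W ∧ Nonempty (CircuitExpansion G F W) := by
  classical
  -- A single path already has more inner vertices than `G` has edges, so there is room for all
  -- edges outside `F` at its vertex. The last summand of `n d` fixes the parity required by the
  -- colors of `d` and `T.π d`.
  let K := Nat.card E(G) + 1
  let n : D → ℕ := fun d => 2 * K + (col d + col (T.π d)).val
  have hnK : ∀ d, 2 * K ≤ n d := fun d => Nat.le_add_right _ _
  have hn : ∀ d, 0 < n d := fun d => by have := hnK d; omega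
  have hn2 : ∀ d, (n d : ZMod 2) = col d + col (T.π d) := by
    intro d
    have h2 : (2 : ZMod 2) = 0 := rfl
    simp only [n]
    push_cast
    rw [ZMod.natCast_val, ZMod.cast_id, h2, zero_mul, zero_add]
  let p : (Σ d, Fin (n d)) → α := fun m => T.hd m.1
  have hM : ∀ x, Nat.card {m // p m = x} = ∑ d with T.hd d = x, n d := by
    intro x
    let ε : {m // p m = x} ≃ Σ d : {d // T.hd d = x}, Fin (n d) :=
      { toFun := fun m => ⟨⟨m.1.1, m.2⟩, m.1.2⟩
        invFun := fun m => ⟨⟨m.1.1, m.2⟩, m.1.2⟩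
        left_inv := fun _ => rfl
        right_inv := fun _ => rfl }
    rw [Nat.card_congr ε, Nat.card_sigma]
    simp only [Nat.card_eq_fintype_card, Fintype.card_fin]
    exact (Finset.sum_subtype _ (by simp) n).symm
  let C : Set β := {e | e ∈ E(G) ∧ e ∉ F}
  have hempty : ∀ x, x ∉ V(G) → Nat.card {e // e ∈ C ∧ G.Inc e x} = 0 ∧
      Nat.card {m // p m = x} = 0 := by
    intro x hx
    have h1 : IsEmpty {e // e ∈ C ∧ G.Inc e x} := ⟨fun e => hx e.2.2.vertex_mem⟩
    have h2 : IsEmpty {m // p m = x} := ⟨fun m => hx (m.2 ▸ T.hd_mem _)⟩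
    simp
  obtain ⟨θ, lab, hθθ, hθ, hlabθ, hlink, hpθ, hex, hinj⟩ := exists_attachment hG p C
    (hE.subset fun e he => he.1) (by
      intro x
      by_cases hx : x ∈ V(G)
      · obtain ⟨d, hd⟩ := T.hd_surj x hx
        have := hE.to_subtype
        have h1 : Nat.card {e // e ∈ C ∧ G.Inc e x} ≤ Nat.card E(G) :=
          Nat.card_mono hE (fun e he => he.1.1)
        have h2 : n d ≤ ∑ d with T.hd d = x, n d :=
          Finset.single_le_sum (f := n) (fun _ _ => Nat.zero_le _) (by simpa using hd)
        have h3 := hnK d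
        rw [hM]
        omega
      · rw [(hempty x hx).1]
        exact Nat.zero_le _) (by
      intro x
      by_cases hx : x ∈ V(G)
      · rw [← ZMod.natCast_eq_zero_iff_even, Nat.cast_add, hM, Nat.cast_sum]
        simp only [hn2]
        rw [hcol x hx]
        exact CharTwo.add_self_eq_zero _
      · rw [(hempty x hx).1, (hempty x hx).2]
        exact ⟨0, rfl⟩)
  -- With heads also in the role of tails, the lemma gives a cyclic order of the arcs that enter
  -- each vertex.
  obtain ⟨ζ, hζ, hζcyc⟩ := exists_perm_sameCycle T.hd T.hd (Equiv.refl D) fun _ => rfl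
  have hbij : Function.Bijective (next hn ζ) :=
    Finite.injective_iff_bijective.1 (next_injective ζ.injective)
  let P : BlockVertex D n → α := fun w => T.hd w.block
  let Θ : BlockVertex D n → BlockVertex D n
    | first d => last (T.π.symm d)
    | mid m => mid (θ m)
    | last d => first (T.π d)
  let Lab : BlockVertex D n → Option β
    | first d => T.lab d
    | mid m => lab m
    | last d => T.lab (T.π d)
  -- Colors alternate along the path of `d`, starting with the color distinct from that of the arc
  -- `d`; the edge leaving the inner vertex of index `i` is one of `i + 1` steps later, hence the
  -- offset `i + 2` from `col d`.
  let κ : BlockVertex D n → Fin 3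
    | first d => bitColor (col d + 1)
    | mid m => bitColor (col m.1 + m.2 + 1 + 1)
    | last d => 2
  let μ : BlockVertex D n → Fin 3
    | first d => bitColor (col d)
    | mid m => 2
    | last d => bitColor (col (T.π d))
  -- By the parity of `n d`, the alternation ends with the color distinct from that of the arc `T.π
  -- d`.
  have hcolπ : ∀ d, col (T.π d) = col d + n d := by
    intro d
    rw [hn2, ← add_assoc, CharTwo.add_self_eq_zero, zero_add]
  have hblock : ∀ w, P (next hn ζ w) = P w := by
    rintro (d | m | d)
    · rfl
    · simp only [next]
      split_ifs <;> rfl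
    · exact hζ d
  have htlπ : ∀ d, T.hd (T.π.symm d) = T.tl d := by
    intro d
    rw [← T.tl_π, Equiv.apply_symm_apply]
  have hLink : ∀ w e, Lab w = some e → G.IsLink e (P w) (P (Θ w)) := by
    rintro (d | m | d) e h
    · have := (T.isLink d e h).symm
      rwa [← htlπ] at this
    · exact (hlink m e h).2
    · have := T.isLink _ e h
      rwa [T.tl_π] at this
  have hΘΘ : ∀ w, Θ (Θ w) = w := by
    rintro (d | m | d) <;> simp [Θ, hθθ]
  have hμΘ : ∀ w, μ (Θ w) = μ w := by
    rintro (d | m | d) <;> simp [Θ, μ]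
  refine ⟨BlockVertex D n, inferInstance, ⟨
    { p := P
      ρ := Equiv.ofBijective (next hn ζ) hbij
      θ := Θ
      lab := Lab
      κ := κ
      μ := μ
      p_mem := fun w => T.hd_mem _
      p_surj := fun x hx => (T.hd_surj x hx).imp' first fun d hd => hd
      p_ρ := hblock
      ρ_ne := ?_
      sameCycle := ?_
      θ_θ := hΘΘ
      θ_ne := ?_
      lab_θ := ?_
      isLink := hLink
      p_θ := ?_
      exists_lab := ?_
      lab_inj := ?_
      μ_θ := hμΘ
      κ_ρ_ne := ?_
      μ_ne := ?_
      μ_ρ_ne := ?_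
      μ_lab := ?_
      connected := ?_ }⟩⟩
  · rintro (d | m | d)
    · simp [next]
    · simp only [Equiv.ofBijective_apply, next]
      split_ifs
      · intro h
        have h := congrArg (fun w : BlockVertex D n => match w with
          | mid m => m.2.val
          | _ => 0) h
        simp at h
      · simp
    · simp [next]
  · intro w w' h
    have hstep : 
        ∀ w, Equiv.Perm.SameCycle (Equiv.ofBijective (next hn ζ) hbij) w (next hn ζ w) :=
      fun w => ⟨1, by simp⟩
    exact rel_of_sameCycle (hn := hn) (Equiv.Perm.SameCycle.equivalence _) ζ
      (fun d => hstep _) (fun m => hstep (mid m)) (fun d => hstep _) (hζcyc _ _ h)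
  · rintro (d | m | d) <;> simp [Θ, hθ]
  · rintro (d | m | d) <;> simp [Θ, Lab, hlabθ]
  · rintro (d | m | d) h
    · exact (htlπ d).trans (T.tl_eq_hd d h)
    · exact hpθ m h
    · exact (T.tl_eq_hd _ h).symm.trans (T.tl_π d)
  · intro e x hx
    by_cases he : e ∈ F
    · obtain ⟨d, hd⟩ := T.exists_lab e he
      rcases hx.eq_or_eq_of_isLink (T.isLink d e hd) with rfl | rfl
      · exact ⟨last (T.π.symm d), by simpa [Lab] using hd, htlπ d⟩
      · exact ⟨first d, hd, rfl⟩
    · obtain ⟨m, hm, hp⟩ := hex e x ⟨hx.edge_mem, he⟩ hx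
      exact ⟨mid m, hm, hp⟩
  · rintro (d | m | d) (d' | m' | d') e h h' hp
    · rw [T.lab_inj d d' e h h']
    · exact absurd (T.mem_of_lab d e h) (hlink m' e h').1.2
    · obtain rfl := T.lab_inj _ _ e h h'
      exact absurd ((T.tl_π d').trans hp.symm) (T.isLink _ e h).ne
    · exact absurd (T.mem_of_lab d' e h') (hlink m e h).1.2
    · rw [hinj m m' e h h' hp]
    · exact absurd (T.mem_of_lab _ e h') (hlink m e h).1.2
    · obtain rfl := T.lab_inj _ _ e h h'
      exact absurd ((T.tl_π d).trans hp) (T.isLink _ e h).ne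
    · exact absurd (T.mem_of_lab _ e h) (hlink m' e h').1.2
    · rw [T.π.injective (T.lab_inj _ _ e h h')]
  · rintro (d | m | d)
    · simpa [next, κ] using bitColor_add_one_ne (col d + 1)
    · simp only [Equiv.ofBijective_apply, next]
      split_ifs
      · simpa [κ, add_assoc] using bitColor_add_one_ne (col m.1 + m.2 + 1 + 1)
      · exact (bitColor_ne_two _).symm
    · exact bitColor_ne_two _
  · rintro (d | m | d)
    · exact (bitColor_add_one_ne _).symm
    · exact (bitColor_ne_two _).symm
    · exact bitColor_ne_two _
  · rintro (d | m | d)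
    · exact (bitColor_ne_two _).symm
    · simp only [Equiv.ofBijective_apply, next]
      split_ifs with h
      · exact (bitColor_ne_two _).symm
      · have h1 : n m.1 = m.2 + 1 := by have := m.2.2; omega
        simp only [κ, μ]
        have h2 : (n m.1 : ZMod 2) = m.2 + 1 := by exact_mod_cast congrArg Nat.cast h1
        rw [hcolπ, h2]
        rw [← add_assoc]
        exact (bitColor_add_one_ne _).symm
    · exact bitColor_ne_two _
  · rintro (d | m | d) e h
    · exact ⟨fun _ => T.mem_of_lab d e h, fun _ => bitColor_ne_two _⟩
    · exact ⟨fun h' => absurd rfl h', fun h' => absurd h' (hlink m e h).1.2⟩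
    · exact ⟨fun _ => T.mem_of_lab _ e h, fun _ => bitColor_ne_two _⟩
  · intro w w' h
    -- Here the paths are followed in the order of `T.π` instead of `ζ`; the two orders differ only
    -- in the step after a last vertex, which is now made along the arc `T.π d`.
    refine rel_of_sameCycle (hn := hn) ⟨fun _ => .refl, ?_, .trans⟩ T.π ?_ ?_ ?_
      (T.sameCycle _ _ h)
    · intro x y hxy
      refine (@Relation.ReflTransGen.stdSymm _ _ ⟨?_⟩).symm _ _ hxy
      rintro u v (h | h | ⟨rfl, h⟩)
      · exact .inr (.inl h)
      · exact .inl h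
      · exact .inr (.inr ⟨(hΘΘ u).symm, (hμΘ u).symm ▸ h⟩)
    · exact fun d => .single (.inl ⟨rfl, bitColor_ne_two _⟩)
    · exact fun m => .single (.inl ⟨rfl, bitColor_ne_two _⟩)
    · exact fun d => .single (.inr (.inr ⟨rfl, bitColor_ne_two _⟩))

end Graph

theorem lemma3p2 {α : Type u} {β : Type v} (G : Graph α β)
    (hV : V(G).Finite) (hE : E(G).Finite) (hG : G.Loopless) (σ : β → ℤˣ)
    (τ₁ τ₂ : β → α → ℤˣ) (f₁ f₂ : β → ℤ)
    (h₁ : G.IsFlow (fun _ => 1) 2 τ₁ f₁) (h₂ : G.IsFlow (fun _ => 1) 2 τ₂ f₂)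
    (hcover : G.flowSupp f₁ ∪ G.flowSupp f₂ = E(G)) :
    ∃ (α' : Type u) (β' : Type (max u v)) (G' : Graph α' β') (σ' : β' → ℤˣ) (ι : β ↪ β'),
      V(G').Finite ∧ E(G').Finite ∧ G'.Loopless ∧
      G'.IsRegularOfDegree 3 ∧ G'.EdgeColorable 3 ∧
      -- `ι` identifies `E(G)` with a subset of `E(G')`, on which `σ'` agrees with `σ`
      ι '' E(G) ⊆ E(G') ∧ (∀ e ∈ E(G), σ' (ι e) = σ e) ∧
      (G.FlowAdmissible σ → G'.FlowAdmissible σ') ∧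
      (∃ J : Graph α' β', J.IsTwoFactor G' ∧
        ∃ f : (G.restrict (G.flowSupp f₁)).components ≃ J.components,
          ∀ I : (G.restrict (G.flowSupp f₁)).components,
            Graph.edgeSign σ E((I : Graph α β)) =
              Graph.edgeSign σ' E((f I : Graph α' β'))) ∧
      (∀ e ∈ E(G') \ ι '' E(G), σ' e = 1) ∧
      (∃ φ : Graph.Iso (G'.contract (E(G') \ ι '' E(G))) G,
        φ.IsSigned σ' σ ∧ ∀ e, ι (φ.edge e : β) = e) := by
  classical
  obtain ⟨D, hD, ⟨T⟩⟩ := Graph.exists_transitionSystem hV hE hG h₁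
  have := Fintype.ofFinite D
  obtain ⟨W, hW, ⟨X⟩⟩ := T.exists_circuitExpansion hE hG
    -- Arcs are colored by the parity of the second flow, dummy arcs by `0`.
    (fun d => (T.lab d).elim 0 fun e => (f₂ e : ZMod 2)) fun x hx =>
      T.sum_parity hE hG h₂ (fun e he he' => by
        have he : e ∈ G.flowSupp f₁ ∪ G.flowSupp f₂ := hcover ▸ he
        exact (he.resolve_left he').2) _ (fun d e h => by simp [h]) (fun d h => by simp [h]) hx
  refine ⟨W, β ⊕ (W ⊕ Sym2 W), X.graph, X.sign σ, Function.Embedding.inl, Set.toFinite _,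
    X.finite_edgeSet, X.isLoopless, X.isRegularOfDegree, X.edgeColorable, ?_, fun _ _ => rfl,
    X.flowAdmissible, ⟨X.factor, X.isTwoFactor, X.exists_factor_components_equiv σ⟩,
    fun e he => X.sign_of_mem_newEdges σ he, X.exists_contract_iso σ⟩
  rintro _ ⟨e, he, rfl⟩
  exact X.inl_mem_edgeSet.2 he
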